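/- All graphs are finite and simple; $|H|$ is the number of vertices of $H$. A $t$-edge-coloured graph is a graph $G$ with an arbitrary (not necessarily proper) map $c:E(G)\to\{1,\dots,t\}$. A rainbow copy of $H$ in $(G,c)$ is a (not necessarily induced) subgraph of $G$ isomorphic to $H$ whose edges have pairwise distinct colours. Let $\mathrm{sat}_t(n,\mathfrak R(H))$ be the minimum number of edges of a $t$-edge-coloured graph $(G,c)$ on $n$ vertices that contains no rainbow copy of $H$, but such that adding any non-edge of $G$ in any colour from $\{1,\dots,t\}$ creates a rainbow copy of $H$. A vertex of $H$ is conical if its degree is $|H|-1$; an edge is pendant if one of its endpoints has degree $1$. $K_r$ with a rotated edge is the graph obtained from $K_r$ by adding a new vertex $w$ and replacing one edge $uv$ by the edge $uw$. **Theorem.** Let $H$ be a connected graph with no conical vertex and with at least one pendant edge, and suppose that $H$ is not isomorphic to $K_r$ with a rotated edge for any odd $r\ge 5$. Then, for every fixed $t\ge |H|^2$, as $n\to\infty$, $$\mathrm{sat}_t(n,\mathfrak R(H))=\Theta(n),$$ where the implied constants may depend on $H$ and $t$. -/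

import Mathlib

open Filter Asymptotics

namespace RainbowSat

/-- A vertex is conical if it is adjacent to all other vertices, i.e. has degree `|H| - 1`. -/
def IsConical {V : Type*} [Fintype V] (H : SimpleGraph V) [DecidableRel H.Adj] (x : V) : Prop :=
  H.degree x = Fintype.card V - 1

/-- An edge is pendant if one of its endpoints has degree `1`. -/
def IsPendantEdge {V : Type*} [Fintype V] (H : SimpleGraph V) [DecidableRel H.Adj]
    (e : Sym2 V) : Prop :=
  e ∈ H.edgeSet ∧ ∃ x ∈ e, H.degree x = 1

/-- Take the complete graph on `V`, add a new vertex `none`, and rotate the edge `uv`: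
replace its endpoint `v` by the new vertex. (Meant for `u ≠ v`.) -/
def rotateEdge {V : Type*} (u v : V) : SimpleGraph (Option V) :=
  (((⊤ : SimpleGraph V).map some).deleteEdges {s(some u, some v)}) ⊔
    SimpleGraph.edge (some u) none

/-- `H` is (isomorphic to) `K_r` with a rotated edge. -/
def IsCliqueWithRotatedEdge {V : Type*} (r : ℕ) (H : SimpleGraph V) : Prop :=
  ∃ u v : Fin r, u ≠ v ∧ Nonempty (H ≃g rotateEdge u v)

/-- The edge-coloured graph `(G, c)` contains a rainbow copy of `H`: a (not necessarily induced)
copy of `H` in `G` whose edges receive pairwise different colours. -/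
def HasRainbowCopy {V W K : Type*} (H : SimpleGraph V) {G : SimpleGraph W}
    (c : G.EdgeLabeling K) : Prop :=
  ∃ f : SimpleGraph.Copy H G, Function.Injective fun e : H.edgeSet => c (f.toHom.mapEdgeSet e)

open Classical in
/-- The colouring of `G + xy` that keeps the colours of the edges of `G` and gives colour `i`
to the new edge `xy`. -/
noncomputable def addColouredEdge {W K : Type*} {G : SimpleGraph W} (c : G.EdgeLabeling K)
    (x y : W) (i : K) : (G ⊔ SimpleGraph.edge x y).EdgeLabeling K :=
  fun e => if h : e.1 ∈ G.edgeSet then c ⟨e.1, h⟩ else i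

/-- `(G, c)` is saturated for the rainbow copies of `H`, with respect to the palette `K`:
it has no rainbow copy of `H`, but adding any non-edge in any colour creates one. -/
def IsRainbowSaturated {V W K : Type*} (H : SimpleGraph V) {G : SimpleGraph W}
    (c : G.EdgeLabeling K) : Prop :=
  ¬ HasRainbowCopy H c ∧
    ∀ x y : W, x ≠ y → ¬ G.Adj x y → ∀ i : K, HasRainbowCopy H (addColouredEdge c x y i)

/-- The `t`-rainbow saturation number `sat_t(n, R(H))`: the minimum number of edges of a
saturated `t`-edge-coloured graph on `n` vertices. -/
noncomputable def rainbowSat {V : Type*} (t n : ℕ) (H : SimpleGraph V) : ℕ :=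
  sInf {m : ℕ | ∃ (G : SimpleGraph (Fin n)) (c : G.EdgeLabeling (Fin t)),
    IsRainbowSaturated H c ∧ G.edgeSet.ncard = m}

end RainbowSat

/-! Lower bound: a saturated graph has at most one isolated vertex. An edge added between two
isolated vertices would form a whole component, whereas `H` is connected on at least three vertices
(`IsRainbowSaturated.le_ncard`).

Upper bound: it suffices to find a coloured scaffold without rainbow `H` in which all but linearly
many pairs are non-edges that create a rainbow `H` when added in any colour. A maximal
rainbow-`H`-free extension is then saturated and gains only linearly many edges
(`hasLinearSaturated_of_scaffold`). The new edge plays the pendant edge `vw`, with `w` the leaf. So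
each typical vertex needs, for every colour `i`, a rainbow copy of `H - w` that avoids `i` and has
`v` at that vertex.

Since `v` is not conical, it has a non-neighbour `u₀`. The scaffold depends on `Q = V \ {v, w}`: -
If `Q` is not a clique, disjoint rainbow cliques on `|H| - 1` vertices serve: a non-edge of `H - w`,
at `v` or away from it, is laid over the edge of colour `i`. - If `Q` is a clique and `v` misses at
least two of its vertices, two rainbow cliques share hubs with an independent set of outer vertices
(`hubGraph`). - Otherwise `H` is `K_r` with a rotated edge, and only the pair `vu₀` can absorb the
colour `i`. For `r = 3` a properly 3-coloured `K_4` works. For even `r` each vertex lies in `r / 2`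
rainbow `r`-cliques whose stars at that vertex partition the `r (r - 1) / 2` colours (`blockGraph`,
`IsStarPartition`). Some block at the vertex then has colour `i` in its star, and no block can be
left along a fresh colour. Odd `r ≥ 5` is excluded by hypothesis. -/

namespace RainbowSat

/-! ### Rainbow copies as functions, and saturated extensions -/

/-- `f` is a rainbow copy of `H` in `G`, where the edge `xy` of `G` has colour `c x y`. -/
structure IsRainbowCopy {V W K : Type*} (H : SimpleGraph V) (G : SimpleGraph W) (c : W → W → K)
    (f : V → W) : Prop where
  injective : Function.Injective f
  adj : ∀ ⦃a b⦄, H.Adj a b → G.Adj (f a) (f b)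
  rainbow : ∀ ⦃a b a' b'⦄, H.Adj a b → H.Adj a' b' →
    c (f a) (f b) = c (f a') (f b') → s(a, b) = s(a', b')

open Classical in
/-- The colour function `c`, changed to `i` on the pair `xy`. -/
noncomputable def recolour {W K : Type*} (c : W → W → K) (x y : W) (i : K) : W → W → K :=
  fun a b => if s(a, b) = s(x, y) then i else c a b

theorem recolour_symm {W K : Type*} {c : W → W → K} (hc : ∀ a b, c a b = c b a) (x y : W) (i : K)
    (a b : W) : recolour c x y i a b = recolour c x y i b a := by
  unfold recolour
  rw [Sym2.eq_swap, hc]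

/-- The type of edge labelings changes with every added edge. A total colour function on pairs does
not; its values on non-edges play no role. -/
theorem hasRainbowCopy_iff {V W K : Type*} {H : SimpleGraph V} {G : SimpleGraph W}
    {C : G.EdgeLabeling K} {c : W → W → K}
    (hC : ∀ x y (h : G.Adj x y), C ⟨s(x, y), h⟩ = c x y) :
    HasRainbowCopy H C ↔ ∃ f, IsRainbowCopy H G c f := by
  constructor
  · rintro ⟨f, hf⟩
    refine ⟨f, f.injective, fun a b h => f.toHom.map_adj h, fun a b a' b' h h' e => ?_⟩
    have := @hf ⟨s(a, b), h⟩ ⟨s(a', b'), h'⟩ (by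
      have h1 := hC _ _ (f.toHom.map_adj h)
      have h2 := hC _ _ (f.toHom.map_adj h')
      exact h1.trans (e.trans h2.symm))
    exact congrArg Subtype.val this
  · rintro ⟨f, hf⟩
    refine ⟨⟨⟨f, fun h => hf.adj h⟩, hf.injective⟩, ?_⟩
    rintro ⟨e, he⟩ ⟨e', he'⟩ hee
    induction e using Sym2.ind with
    | _ a b =>
    induction e' using Sym2.ind with
    | _ a' b' =>
    apply Subtype.ext
    apply hf.rainbow he he'
    have h1 := hC _ _ (hf.adj he)
    have h2 := hC _ _ (hf.adj he')
    exact h1.symm.trans (hee.trans h2)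

theorem IsRainbowCopy.mono {V W K : Type*} {H : SimpleGraph V} {G G' : SimpleGraph W}
    {c c' : W → W → K} {f : V → W} (hf : IsRainbowCopy H G c f) (hG : G ≤ G')
    (hc : ∀ x y, G.Adj x y → c' x y = c x y) : IsRainbowCopy H G' c' f where
  injective := hf.injective
  adj _ _ h := hG (hf.adj h)
  rainbow a b a' b' h h' e := hf.rainbow h h' (by
    rwa [hc _ _ (hf.adj h), hc _ _ (hf.adj h')] at e)

theorem sup_edge_adj_iff {W : Type*} {G : SimpleGraph W} {x y a b : W} (hxy : x ≠ y) :
    (G ⊔ SimpleGraph.edge x y).Adj a b ↔ G.Adj a b ∨ s(a, b) = s(x, y) := by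
  rw [SimpleGraph.sup_adj, SimpleGraph.edge_adj]
  constructor
  · rintro (h | ⟨⟨rfl, rfl⟩ | ⟨rfl, rfl⟩, h⟩) <;> simp_all [Sym2.eq_swap]
  · rintro (h | h)
    · exact Or.inl h
    · right
      rw [Sym2.eq_iff] at h
      refine ⟨by tauto, ?_⟩
      rcases h with ⟨rfl, rfl⟩ | ⟨rfl, rfl⟩
      · exact hxy
      · exact hxy.symm

theorem addColouredEdge_apply {W K : Type*} {G : SimpleGraph W} {C : G.EdgeLabeling K}
    {c : W → W → K} (hC : ∀ x y (h : G.Adj x y), C ⟨s(x, y), h⟩ = c x y) {x y : W} (hxy : x ≠ y)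
    (hG : ¬ G.Adj x y) (i : K) (a b : W) (h : (G ⊔ SimpleGraph.edge x y).Adj a b) :
    addColouredEdge C x y i ⟨s(a, b), h⟩ = recolour c x y i a b := by
  unfold addColouredEdge recolour
  by_cases hab : G.Adj a b
  · have h1 : ¬ s(a, b) = s(x, y) := by
      intro e
      rw [← SimpleGraph.mem_edgeSet, e] at hab
      exact hG hab
    rw [dif_pos (show s(a, b) ∈ G.edgeSet from hab), if_neg h1]
    exact hC a b hab
  · rw [dif_neg (show ¬ s(a, b) ∈ G.edgeSet from hab), if_pos]
    exact ((sup_edge_adj_iff hxy).1 h).resolve_left hab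

/-- Every rainbow-`H`-free coloured graph extends to a saturated one, by edges that, taken singly,
do not create a rainbow copy of `H`. -/
theorem exists_saturated_extension {V W K : Type*} [Finite W] {H : SimpleGraph V}
    {G₀ : SimpleGraph W} {c₀ : W → W → K} (hc₀ : ∀ a b, c₀ a b = c₀ b a)
    (hfree : ¬ ∃ f, IsRainbowCopy H G₀ c₀ f) :
    ∃ (G : SimpleGraph W) (C : G.EdgeLabeling K), IsRainbowSaturated H C ∧
      ∀ x y, G.Adj x y → G₀.Adj x y ∨
        ∃ i, ¬ ∃ f, IsRainbowCopy H (G₀ ⊔ SimpleGraph.edge x y) (recolour c₀ x y i) f := by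
  classical
  let P : SimpleGraph W → Prop := fun G => G₀ ≤ G ∧ ∃ c : W → W → K, (∀ a b, c a b = c b a) ∧
    (∀ a b, G₀.Adj a b → c a b = c₀ a b) ∧ ¬ ∃ f, IsRainbowCopy H G c f
  obtain ⟨G, hG⟩ := Set.Finite.exists_maximal (s := {G | P G}) (Set.toFinite _)
    ⟨G₀, le_rfl, c₀, hc₀, fun _ _ _ => rfl, hfree⟩
  obtain ⟨⟨hle, c, hc, hext, hfr⟩, hmax⟩ := hG
  let C : G.EdgeLabeling K := fun e => Sym2.lift ⟨c, hc⟩ e.1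
  have hC : ∀ x y (h : G.Adj x y), C ⟨s(x, y), h⟩ = c x y := fun x y h => rfl
  refine ⟨G, C, ⟨by rwa [hasRainbowCopy_iff hC], ?_⟩, ?_⟩
  · intro x y hxy hnadj i
    rw [hasRainbowCopy_iff (addColouredEdge_apply hC hxy hnadj i)]
    by_contra hcon
    have hP : P (G ⊔ SimpleGraph.edge x y) := by
      refine ⟨hle.trans le_sup_left, recolour c x y i, recolour_symm hc x y i, ?_, hcon⟩
      intro a b hab
      have : ¬ s(a, b) = s(x, y) := by
        intro e
        rw [← SimpleGraph.mem_edgeSet, e] at hab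
        exact hnadj (hle hab)
      rw [recolour, if_neg this, hext a b hab]
    have := hmax hP le_sup_left
    exact hnadj (this ((sup_edge_adj_iff hxy).2 (Or.inr rfl)))
  · intro x y hxy
    by_cases h0 : G₀.Adj x y
    · exact Or.inl h0
    -- `G₀` plus the pair `xy` in its final colour is a coloured subgraph of `G`, hence free of
    -- rainbow copies.
    · refine Or.inr ⟨c x y, ?_⟩
      rintro ⟨f, hf⟩
      refine hfr ⟨f, hf.mono (sup_le hle ?_) ?_⟩
      · intro a b hab
        rw [SimpleGraph.edge_adj] at hab
        rcases hab with ⟨⟨rfl, rfl⟩ | ⟨rfl, rfl⟩, -⟩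
        · exact hxy
        · exact hxy.symm
      · intro a b hab
        rw [recolour]
        split_ifs with h
        · rw [Sym2.eq_iff] at h
          rcases h with ⟨rfl, rfl⟩ | ⟨rfl, rfl⟩
          · rfl
          · exact hc _ _
        · exact hext a b (((sup_edge_adj_iff hxy.ne).1 hab).resolve_right h)

/-! ### Linear upper bound from a scaffold -/

theorem IsRainbowCopy.of_comap {V W X K : Type*} {H : SimpleGraph V} {G : SimpleGraph X}
    {c : X → X → K} {p : W → X} (hp : Function.Injective p) {f : V → W}
    (hf : IsRainbowCopy H (G.comap p) (fun a b => c (p a) (p b)) f) :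
    IsRainbowCopy H G c (p ∘ f) where
  injective := hp.comp hf.injective
  adj _ _ h := hf.adj h
  rainbow _ _ _ _ h h' e := hf.rainbow h h' e

theorem exists_isRainbowCopy_comap {V W X K : Type*} {H : SimpleGraph V} {G : SimpleGraph X}
    {c : X → X → K} {p : W → X} (hp : Function.Injective p) {x y : W} (hxy : x ≠ y) {i : K}
    {f : V → X} (hf : IsRainbowCopy H (G ⊔ SimpleGraph.edge (p x) (p y))
      (recolour c (p x) (p y) i) f) (hr : ∀ a, f a ∈ Set.range p) :
    ∃ g, IsRainbowCopy H (G.comap p ⊔ SimpleGraph.edge x y)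
      (recolour (fun a b => c (p a) (p b)) x y i) g := by
  choose g hg using hr
  have hs : ∀ a b, s(f a, f b) = s(p x, p y) ↔ s(g a, g b) = s(x, y) := by
    intro a b
    rw [← hg a, ← hg b]
    exact (Sym2.map.injective hp).eq_iff (a := s(g a, g b)) (b := s(x, y))
  have hcol : ∀ a b, recolour (fun a b => c (p a) (p b)) x y i (g a) (g b) =
      recolour c (p x) (p y) i (f a) (f b) := by
    intro a b
    by_cases h : s(g a, g b) = s(x, y)
    · rw [recolour, recolour, if_pos h, if_pos ((hs a b).2 h)]
    · rw [recolour, recolour, if_neg h, if_neg (mt (hs a b).1 h), hg, hg]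
  refine ⟨g, fun a b h => hf.injective ?_, fun a b h => ?_, fun a b a' b' h h' e => ?_⟩
  · rw [← hg a, ← hg b, h]
  · have := hf.adj h
    rw [sup_edge_adj_iff (hp.ne hxy), hs] at this
    rw [sup_edge_adj_iff hxy, SimpleGraph.comap_adj, hg, hg]
    exact this
  · rw [hcol, hcol] at e
    exact hf.rainbow h h' e

/-- Every edge meets `Z` or lies inside a fibre of `κ`; each kind accounts for at most `N * n`
ordered pairs. -/
theorem ncard_le_of_fibers {n N : ℕ} {G : SimpleGraph (Fin n)} {Z : Finset (Fin n)}
    (hZ : Z.card ≤ N) {κ : Fin n → ℕ} (hκ : ∀ j, (Finset.univ.filter fun x => κ x = j).card ≤ N)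
    (hG : ∀ x y, x ∉ Z → y ∉ Z → κ x ≠ κ y → ¬ G.Adj x y) :
    G.edgeSet.ncard ≤ 2 * N * n := by
  classical
  let S : Finset (Fin n × Fin n) := Z ×ˢ Finset.univ
  let T : Finset (Fin n × Fin n) := Finset.univ.filter fun q => κ q.1 = κ q.2
  have hsub : G.edgeSet ⊆ ((S ∪ T).image fun q => s(q.1, q.2) : Finset (Sym2 (Fin n))) := by
    intro e he
    induction e using Sym2.ind with
    | _ x y =>
    simp only [Finset.coe_image, Set.mem_image, Finset.mem_coe, Finset.mem_union]
    by_cases hx : x ∈ Z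
    · exact ⟨(x, y), Or.inl (by simp [S, hx]), rfl⟩
    by_cases hy : y ∈ Z
    · exact ⟨(y, x), Or.inl (by simp [S, hy]), Sym2.eq_swap⟩
    by_cases hk : κ x = κ y
    · exact ⟨(x, y), Or.inr (by simp [T, hk]), rfl⟩
    · exact absurd he (hG x y hx hy hk)
  have hS : S.card ≤ N * n := by
    simp only [S, Finset.card_product, Finset.card_univ, Fintype.card_fin]
    exact Nat.mul_le_mul_right _ hZ
  have hT : T.card ≤ N * n := by
    have : T.card ≤ N * (Finset.univ : Finset (Fin n)).card := by
      refine Finset.card_le_mul_card_image_of_maps_to (f := Prod.fst) (fun _ _ => by simp) N ?_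
      intro b _
      refine le_trans ?_ (hκ (κ b))
      refine Finset.card_le_card_of_injOn Prod.snd ?_ ?_
      · intro q hq
        simp only [T, Finset.coe_filter, Finset.mem_filter, Finset.mem_univ, true_and,
          Set.mem_ofPred_eq] at hq ⊢
        rw [← hq.1, hq.2]
      · rintro ⟨q1, q2⟩ hq ⟨q3, q4⟩ hq' h
        simp only [T, Finset.coe_filter, Finset.mem_filter, Finset.mem_univ, true_and,
          Set.mem_ofPred_eq] at hq hq' h
        rw [Prod.mk.injEq]
        exact ⟨hq.2.trans hq'.2.symm, h⟩
    simpa using this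
  calc G.edgeSet.ncard ≤ _ := Set.ncard_le_ncard hsub (Finset.finite_toSet _)
    _ = _ := Set.ncard_coe_finset _
    _ ≤ (S ∪ T).card := Finset.card_image_le
    _ ≤ S.card + T.card := Finset.card_union_le _ _
    _ ≤ 2 * N * n := by linarith [hS, hT]

/-- There are saturated `t`-edge-coloured graphs with a linear number of edges. -/
def HasLinearSaturated {V : Type*} (H : SimpleGraph V) (t : ℕ) : Prop :=
  ∃ N : ℕ, ∀ n : ℕ, ∃ (G : SimpleGraph (Fin n)) (C : G.EdgeLabeling (Fin t)),
    IsRainbowSaturated H C ∧ G.edgeSet.ncard ≤ N * n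

/-- The scaffold may be infinite; `p` cuts out `n` of its vertices. A pair outside `Z` in different
fibres is never added by a saturated extension, because in every colour it would complete a rainbow
copy within the range of `p`. -/
theorem hasLinearSaturated_of_scaffold {V X : Type*} {H : SimpleGraph V} {t : ℕ}
    {G : SimpleGraph X} {c : X → X → Fin t} (hc : ∀ a b, c a b = c b a)
    (hfree : ¬ ∃ f, IsRainbowCopy H G c f) (N : ℕ)
    (h : ∀ n : ℕ, ∃ p : Fin n → X, Function.Injective p ∧ ∃ Z : Finset (Fin n), Z.card ≤ N ∧
      ∃ κ : Fin n → ℕ, (∀ j, (Finset.univ.filter fun x => κ x = j).card ≤ N) ∧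
        ∀ x y, x ∉ Z → y ∉ Z → κ x ≠ κ y → ¬ G.Adj (p x) (p y) ∧
          ∀ i, ∃ f : V → X, IsRainbowCopy H (G ⊔ SimpleGraph.edge (p x) (p y))
            (recolour c (p x) (p y) i) f ∧ ∀ a, f a ∈ Set.range p) :
    HasLinearSaturated H t := by
  refine ⟨2 * N, fun n => ?_⟩
  obtain ⟨p, hp, Z, hZ, κ, hκ, hsat⟩ := h n
  obtain ⟨G', C, hC, hG'⟩ := exists_saturated_extension (H := H) (G₀ := G.comap p)
    (c₀ := fun a b => c (p a) (p b)) (fun a b => hc _ _)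
    (by rintro ⟨f, hf⟩; exact hfree ⟨_, hf.of_comap hp⟩)
  refine ⟨G', C, hC, ncard_le_of_fibers hZ hκ fun x y hx hy hxy hadj => ?_⟩
  obtain ⟨h1, h2⟩ := hsat x y hx hy hxy
  rcases hG' x y hadj with h0 | ⟨i, hi⟩
  · exact h1 h0
  · obtain ⟨f, hf, hr⟩ := h2 i
    exact hi (exists_isRainbowCopy_comap hp hadj.ne hf hr)

/-! ### Linear lower bound -/

theorem _root_.SimpleGraph.Connected.mem_of_adj_closed {V : Type*} {H : SimpleGraph V}
    (hconn : H.Connected) {S : Set V} (hS : ∀ u v, H.Adj u v → u ∈ S → v ∈ S) {a : V}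
    (ha : a ∈ S) (z : V) : z ∈ S := by
  obtain ⟨w⟩ := hconn.preconnected a z
  induction w with
  | nil => exact ha
  | cons h _ ih => exact ih (hS _ _ h ha)

/-- In a saturated graph, two vertices cannot both be isolated. -/
theorem IsRainbowSaturated.not_isolated {V W K : Type*} {H : SimpleGraph V}
    (hconn : H.Connected) (hcard : ∀ a b : V, ∃ z, z ≠ a ∧ z ≠ b) {G : SimpleGraph W}
    {C : G.EdgeLabeling K} (hC : IsRainbowSaturated H C) (i : K) {x y : W} (hxy : x ≠ y)
    (hx : ∀ z, ¬ G.Adj x z) (hy : ∀ z, ¬ G.Adj y z) : False := by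
  classical
  let c : W → W → K := fun a b => if h : G.Adj a b then C ⟨s(a, b), h⟩ else i
  have hCc : ∀ a b (h : G.Adj a b), C ⟨s(a, b), h⟩ = c a b := fun a b h => by
    simp only [c, dif_pos h]
  obtain ⟨hfree, hsat⟩ := hC
  have hs := hsat x y hxy (hx y) i
  rw [hasRainbowCopy_iff hCc] at hfree
  rw [hasRainbowCopy_iff (addColouredEdge_apply hCc hxy (hx y) i)] at hs
  obtain ⟨f, hf⟩ := hs
  -- A copy not using the new edge would already be rainbow in `G`.
  have huse : ∃ a b, H.Adj a b ∧ f a = x ∧ f b = y := by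
    by_contra hcon
    push Not at hcon
    have hne : ∀ a b, H.Adj a b → ¬ s(f a, f b) = s(x, y) := by
      intro a b hab e
      rw [Sym2.eq_iff] at e
      rcases e with ⟨e1, e2⟩ | ⟨e1, e2⟩
      · exact hcon a b hab e1 e2
      · exact hcon b a hab.symm e2 e1
    refine hfree ⟨f, hf.injective, fun a b hab => ?_, fun a b a' b' hab hab' e => ?_⟩
    · exact ((sup_edge_adj_iff hxy).1 (hf.adj hab)).resolve_right (hne a b hab)
    · apply hf.rainbow hab hab'
      rwa [recolour, recolour, if_neg (hne a b hab), if_neg (hne a' b' hab')]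
  obtain ⟨a, b, hab, rfl, rfl⟩ := huse
  -- The new edge is the only edge at `x` or `y`, so `{a, b}` is closed under adjacency in `H`.
  have hstep : ∀ u v, H.Adj u v → (u = a ∨ u = b) → (v = a ∨ v = b) := by
    intro u v huv hu
    have h1 := (sup_edge_adj_iff hxy).1 (hf.adj huv)
    rcases h1 with h1 | h1
    · rcases hu with rfl | rfl
      · exact absurd h1 (hx _)
      · exact absurd h1 (hy _)
    · rw [Sym2.eq_iff] at h1
      rcases h1 with ⟨-, h⟩ | ⟨-, h⟩
      · exact Or.inr (hf.injective h)
      · exact Or.inl (hf.injective h)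
  obtain ⟨z, hza, hzb⟩ := hcard a b
  have : z = a ∨ z = b :=
    hconn.mem_of_adj_closed (S := {u | u = a ∨ u = b}) hstep (Or.inl rfl : a = a ∨ a = b) z
  tauto

theorem IsRainbowSaturated.le_ncard {V K : Type*} {H : SimpleGraph V}
    (hconn : H.Connected) (hcard : ∀ a b : V, ∃ z, z ≠ a ∧ z ≠ b) {n : ℕ}
    {G : SimpleGraph (Fin n)} {C : G.EdgeLabeling K} (hC : IsRainbowSaturated H C) (i : K) :
    n ≤ 2 * G.edgeSet.ncard + 1 := by
  classical
  let S : Finset (Fin n) := Finset.univ.filter fun x => G.degree x = 0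
  have hS : S.card ≤ 1 := by
    rw [Finset.card_le_one]
    intro x hx y hy
    by_contra hxy
    simp only [S, Finset.mem_filter, Finset.mem_univ, true_and] at hx hy
    refine hC.not_isolated hconn hcard i hxy (fun z hz => ?_) (fun z hz => ?_)
    · exact absurd ((G.degree_pos_iff_exists_adj x).2 ⟨z, hz⟩) (by omega)
    · exact absurd ((G.degree_pos_iff_exists_adj y).2 ⟨z, hz⟩) (by omega)
  have hsum := G.sum_degrees_eq_twice_card_edges
  have hE : G.edgeSet.ncard = G.edgeFinset.card := by
    rw [← SimpleGraph.coe_edgeFinset, Set.ncard_coe_finset]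
  have h1 : n ≤ ∑ x : Fin n, (G.degree x + if G.degree x = 0 then 1 else 0) := by
    calc n = ∑ x : Fin n, 1 := by simp
      _ ≤ _ := Finset.sum_le_sum fun x _ => by split_ifs with h <;> omega
  rw [Finset.sum_add_distrib, hsum, ← Finset.card_filter] at h1
  rw [hE]
  change n ≤ _ + S.card at h1
  omega

theorem isTheta_of_hasLinearSaturated {V : Type*} {H : SimpleGraph V}
    (hconn : H.Connected) (hcard : ∀ a b : V, ∃ z, z ≠ a ∧ z ≠ b) {t : ℕ} (ht : 0 < t)
    (h : HasLinearSaturated H t) :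
    (fun n : ℕ => (rainbowSat t n H : ℝ)) =Θ[atTop] (fun n : ℕ => (n : ℝ)) := by
  obtain ⟨N, hN⟩ := h
  have hlow : ∀ n, n ≤ 2 * rainbowSat t n H + 1 := by
    intro n
    obtain ⟨G, C, hC, -⟩ := hN n
    obtain ⟨G', C', hC', hm⟩ := Nat.sInf_mem
      (s := {m : ℕ | ∃ (G : SimpleGraph (Fin n)) (c : G.EdgeLabeling (Fin t)),
        IsRainbowSaturated H c ∧ G.edgeSet.ncard = m}) ⟨_, G, C, hC, rfl⟩
    rw [rainbowSat, ← hm]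
    exact hC'.le_ncard hconn hcard (⟨0, ht⟩ : Fin t)
  have hup : ∀ n, rainbowSat t n H ≤ N * n := by
    intro n
    obtain ⟨G, C, hC, hle⟩ := hN n
    refine le_trans (Nat.sInf_le ?_) hle
    exact ⟨G, C, hC, rfl⟩
  constructor
  · refine IsBigO.of_bound N (Eventually.of_forall fun n => ?_)
    simp only [Real.norm_natCast]
    exact_mod_cast hup n
  · refine IsBigO.of_bound 4 ((eventually_ge_atTop 2).mono fun n hn => ?_)
    simp only [Real.norm_natCast]
    have := hlow n
    exact_mod_cast (by omega : n ≤ 4 * rainbowSat t n H)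

/-! ### Partial copies and disjoint components -/

/-- `f` is a rainbow copy of `H - w` in `G` that does not use the colour `i`; the value of `f` at
`w` is irrelevant. -/
structure IsPartialCopy {V W K : Type*} (H : SimpleGraph V) (w : V) (G : SimpleGraph W)
    (c : W → W → K) (i : K) (f : V → W) : Prop where
  injOn : ∀ ⦃a b⦄, a ≠ w → b ≠ w → f a = f b → a = b
  adj : ∀ ⦃a b⦄, a ≠ w → b ≠ w → H.Adj a b → G.Adj (f a) (f b)
  rainbow : ∀ ⦃a b a' b'⦄, a ≠ w → b ≠ w → a' ≠ w → b' ≠ w → H.Adj a b → H.Adj a' b' →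
    c (f a) (f b) = c (f a') (f b') → s(a, b) = s(a', b')
  avoid : ∀ ⦃a b⦄, a ≠ w → b ≠ w → H.Adj a b → c (f a) (f b) ≠ i

theorem edge_cases_of_leaf {V : Type*} {H : SimpleGraph V} {v w : V}
    (hw : ∀ u, H.Adj w u → u = v) {a b : V} (hab : H.Adj a b) :
    (a ≠ w ∧ b ≠ w) ∨ s(a, b) = s(v, w) := by
  by_cases ha : a = w
  · subst ha
    rw [hw b hab]
    exact Or.inr Sym2.eq_swap
  by_cases hb : b = w
  · subst hb
    rw [hw a hab.symm]
    exact Or.inr rfl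
  · exact Or.inl ⟨ha, hb⟩

/-- A partial copy in which a new edge of colour `i` plays the role of the pendant edge. -/
theorem IsPartialCopy.isRainbowCopy {V W K : Type*} {H : SimpleGraph V} {v w : V}
    (hw : ∀ u, H.Adj w u → u = v) {G : SimpleGraph W} {c : W → W → K} {i : K} {f : V → W}
    (hf : IsPartialCopy H w G c i f) (hinj : ∀ a, a ≠ w → f a ≠ f w)
    (hvw : f v ≠ f w) :
    IsRainbowCopy H (G ⊔ SimpleGraph.edge (f v) (f w)) (recolour c (f v) (f w) i) f := by
  have hI : Function.Injective f := by
    intro a b hab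
    by_cases ha : a = w
    · by_contra hb
      subst ha
      exact hinj b (Ne.symm hb) hab.symm
    · by_cases hb : b = w
      · subst hb
        exact absurd hab (hinj a ha)
      · exact hf.injOn ha hb hab
  have hs : ∀ a b, s(f a, f b) = s(f v, f w) ↔ s(a, b) = s(v, w) := fun a b =>
    (Sym2.map.injective hI).eq_iff (a := s(a, b)) (b := s(v, w))
  have hne : ∀ a b, a ≠ w → b ≠ w → ¬ s(a, b) = s(v, w) := by
    intro a b ha hb h
    rw [Sym2.eq_iff] at h
    tauto
  refine ⟨hI, fun a b hab => ?_, fun a b a' b' hab hab' e => ?_⟩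
  · rw [sup_edge_adj_iff hvw, hs]
    rcases edge_cases_of_leaf hw hab with ⟨ha, hb⟩ | h
    · exact Or.inl (hf.adj ha hb hab)
    · exact Or.inr h
  · unfold recolour at e
    rcases edge_cases_of_leaf hw hab with ⟨ha, hb⟩ | h <;>
      rcases edge_cases_of_leaf hw hab' with ⟨ha', hb'⟩ | h'
    · rw [if_neg ((hs _ _).not.2 (hne _ _ ha hb)), if_neg ((hs _ _).not.2 (hne _ _ ha' hb'))] at e
      exact hf.rainbow ha hb ha' hb' hab hab' e
    · rw [if_neg ((hs _ _).not.2 (hne _ _ ha hb)), if_pos ((hs _ _).2 h')] at e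
      exact absurd e (hf.avoid ha hb hab)
    · rw [if_neg ((hs _ _).not.2 (hne _ _ ha' hb')), if_pos ((hs _ _).2 h)] at e
      exact absurd e.symm (hf.avoid ha' hb' hab')
    · rw [h, h']

/-- The disjoint union of infinitely many copies of `G`. -/
def copies {F : Type*} (G : SimpleGraph F) : SimpleGraph (ℕ × F) where
  Adj a b := a.1 = b.1 ∧ G.Adj a.2 b.2
  symm := ⟨fun _ _ h => ⟨h.1.symm, h.2.symm⟩⟩
  loopless := ⟨fun _ h => G.loopless.irrefl _ h.2⟩

/-- In a disjoint union of copies of `G`, an edge of colour `i` between two components extends a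
copy of `H - w` rooted at one end by the leaf at the other end. Connectedness of `H` keeps rainbow
copies inside one component. -/
theorem hasLinearSaturated_of_component {V F : Type*} [Fintype F] [Nonempty F]
    {H : SimpleGraph V} (hconn : H.Connected) {v w : V} (hvw : v ≠ w)
    (hw : ∀ u, H.Adj w u → u = v) {t : ℕ} {G : SimpleGraph F} {c : F → F → Fin t}
    (hc : ∀ a b, c a b = c b a) (hfree : ∀ f, ¬ IsRainbowCopy H G c f)
    (hroot : ∀ x i, ∃ f, IsPartialCopy H w G c i f ∧ f v = x) : HasLinearSaturated H t := by
  classical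
  set N := Fintype.card F with hN
  have hN0 : 0 < N := Fintype.card_pos
  let e : F ≃ Fin N := Fintype.equivFin F
  refine hasLinearSaturated_of_scaffold (G := copies G) (c := fun a b => c a.2 b.2)
    (fun a b => hc _ _) ?_ N fun n => ?_
  · rintro ⟨f, hf⟩
    have hconst : ∀ a b, (f a).1 = (f b).1 := by
      intro a b
      obtain ⟨p⟩ := hconn.preconnected a b
      induction p with
      | nil => rfl
      | cons h _ ih => exact (hf.adj h).1.trans ih
    refine hfree (fun a => (f a).2) ⟨fun a b hab => ?_, fun a b h => (hf.adj h).2,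
      fun a b a' b' h h' => hf.rainbow h h'⟩
    exact hf.injective (Prod.ext (hconst a b) hab)
  · let p : Fin n → ℕ × F := fun x => (x.val / N, e.symm ⟨x.val % N, Nat.mod_lt _ hN0⟩)
    have hp : Function.Injective p := by
      intro x y h
      simp only [p, Prod.mk.injEq, EmbeddingLike.apply_eq_iff_eq, Fin.mk.injEq] at h
      apply Fin.ext
      rw [← Nat.div_add_mod x.val N, ← Nat.div_add_mod y.val N, h.1, h.2]
    have hfib : ∀ j, (Finset.univ.filter fun x : Fin n => x.val / N = j).card ≤ N := by
      intro j
      rw [hN, ← Finset.card_univ]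
      refine Finset.card_le_card_of_injOn (fun x => (p x).2) (fun _ _ => by simp) ?_
      intro x hx y hy h
      simp only [Finset.coe_filter, Finset.mem_univ, true_and, Set.mem_ofPred_eq] at hx hy
      exact hp (Prod.ext (hx.trans hy.symm) h)
    -- The exceptional set is the last, possibly incomplete, component. The component of `x` must be
    -- complete to host the partial copy.
    refine ⟨p, hp, Finset.univ.filter fun x => x.val / N = n / N, hfib _, fun x => x.val / N, hfib,
      fun x y hx hy hxy => ⟨fun h => hxy h.1, fun i => ?_⟩⟩
    obtain ⟨f, hf, hfv⟩ := hroot (p x).2 i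
    let g : V → ℕ × F := fun a => if a = w then p y else (x.val / N, f a)
    have hgw : g w = p y := if_pos rfl
    have hg : ∀ a, a ≠ w → g a = (x.val / N, f a) := fun a ha => if_neg ha
    have hgv : g v = p x := by rw [hg v hvw, hfv]
    refine ⟨g, ?_, fun a => ?_⟩
    · rw [← hgw, ← hgv]
      refine IsPartialCopy.isRainbowCopy hw ⟨fun a b ha hb h => ?_, fun a b ha hb h => ?_,
        fun a b a' b' ha hb ha' hb' h h' h'' => ?_, fun a b ha hb h => ?_⟩ (fun a ha h => ?_)
        (fun h => ?_)
      · rw [hg a ha, hg b hb, Prod.mk.injEq] at h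
        exact hf.injOn ha hb h.2
      · rw [hg a ha, hg b hb]
        exact ⟨rfl, hf.adj ha hb h⟩
      · rw [hg a ha, hg b hb, hg a' ha', hg b' hb'] at h''
        exact hf.rainbow ha hb ha' hb' h h' h''
      · rw [hg a ha, hg b hb]
        exact hf.avoid ha hb h
      · rw [hg a ha, hgw] at h
        exact hxy (congrArg Prod.fst h)
      · rw [hgv, hgw] at h
        exact hxy (congrArg Prod.fst h)
    · by_cases ha : a = w
      · exact ⟨y, by rw [ha, hgw]⟩
      · rw [hg a ha]
        simp only [Finset.mem_filter, Finset.mem_univ, true_and] at hx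
        have h1 : x.val / N < n / N :=
          lt_of_le_of_ne (Nat.div_le_div_right x.isLt.le) hx
        have h2 : N * (x.val / N + 1) ≤ n :=
          (Nat.mul_le_mul_left _ h1).trans (Nat.mul_div_le _ _)
        have h3 := (e (f a)).isLt
        rw [Nat.mul_add, Nat.mul_one] at h2
        refine ⟨⟨N * (x.val / N) + (e (f a)).val, by omega⟩, ?_⟩
        refine Prod.ext ?_ ?_
        · simp only [p]
          rw [Nat.mul_add_div hN0, Nat.div_eq_of_lt h3, Nat.add_zero]
        · simp only [p, Nat.mul_add_mod, Nat.mod_eq_of_lt h3, Fin.eta, Equiv.symm_apply_apply]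

/-! ### Small components: rainbow cliques and the path on four vertices -/

/-- A bijection from the finite set `s` onto `P` with some prescribed values. -/
theorem exists_bijOn_finset {V P : Type*} [Fintype P] [Nonempty P] (s : Finset V)
    (hcard : s.card = Fintype.card P) {n : ℕ} (a : Fin n → V) (ha : Function.Injective a)
    (has : ∀ k, a k ∈ s) (p : Fin n → P) (hp : Function.Injective p) :
    ∃ σ : V → P, (∀ ⦃a b⦄, a ∈ s → b ∈ s → σ a = σ b → a = b) ∧
      ∀ k, σ (a k) = p k := by
  classical
  let e : s ≃ P := Fintype.equivOfCardEq (by rw [Fintype.card_coe, hcard])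
  -- Any bijection can be corrected by a permutation, as the symmetric group is `n`-transitive.
  obtain ⟨g, hg⟩ := (Equiv.Perm.isMultiplyPretransitive P n).exists_smul_eq
    ((⟨fun k => ⟨a k, has k⟩, fun i j h => ha (congrArg Subtype.val h)⟩ : Fin n ↪ s).trans
      e.toEmbedding) ⟨p, hp⟩
  let τ : s ≃ P := e.trans g
  have hτ : ∀ k, τ ⟨a k, has k⟩ = p k := fun k => DFunLike.congr_fun hg k
  let σ : V → P := fun u => if h : u ∈ s then τ ⟨u, h⟩ else Classical.arbitrary P
  have hσ : ∀ u (h : u ∈ s), σ u = τ ⟨u, h⟩ := fun u h => dif_pos h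
  refine ⟨σ, fun a b ha hb h => ?_, fun k => ?_⟩
  · rw [hσ a ha, hσ b hb] at h
    exact congrArg Subtype.val (τ.injective h)
  · rw [hσ _ (has k), hτ]

/-- If `H` has a pendant edge `vw` such that `v` has a non-neighbour and the graph on the
remaining vertices is not complete, disjoint rainbow cliques are nearly saturated. -/
theorem hasLinearSaturated_of_not_clique {V : Type*} [Fintype V] {H : SimpleGraph V}
    (hconn : H.Connected) {v w : V} (hvw : v ≠ w) (hw : ∀ u, H.Adj w u → u = v)
    {u₀ : V} (hu₀w : u₀ ≠ w) (hu₀v : u₀ ≠ v) (hu₀ : ¬ H.Adj v u₀)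
    {u₁ u₂ : V} (hu₁w : u₁ ≠ w) (hu₁v : u₁ ≠ v) (hu₂w : u₂ ≠ w) (hu₂v : u₂ ≠ v) (hu₁₂ : u₁ ≠ u₂)
    (hu : ¬ H.Adj u₁ u₂) {t : ℕ} (ht : Fintype.card V ^ 2 ≤ t) : HasLinearSaturated H t := by
  classical
  let F := {u : V // u ≠ w}
  have hF : Fintype.card F + 1 = Fintype.card V := by
    have : 0 < Fintype.card V := Fintype.card_pos_iff.2 ⟨v⟩
    rw [Fintype.card_subtype_compl, Fintype.card_subtype_eq]
    omega
  have hFs : (Finset.univ.erase w).card = Fintype.card F := by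
    rw [Finset.card_erase_of_mem (Finset.mem_univ _), Finset.card_univ]
    omega
  have : Nonempty F := ⟨⟨v, hvw⟩⟩
  obtain ⟨χ⟩ : Nonempty (Sym2 F ↪ Fin t) := by
    refine Function.Embedding.nonempty_of_card_le ?_
    rw [Sym2.card, Fintype.card_fin]
    refine le_trans ?_ ht
    rw [← hF, Nat.choose_two_right]
    refine (Nat.div_le_self _ _).trans ?_
    rw [sq]
    exact Nat.mul_le_mul_left _ (by omega)
  refine hasLinearSaturated_of_component hconn hvw hw (G := (⊤ : SimpleGraph F))
    (c := fun a b => χ s(a, b)) (fun a b => by rw [Sym2.eq_swap]) ?_ ?_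
  · intro f hf
    have := Fintype.card_le_of_injective f hf.injective
    omega
  · intro x i
    suffices h : ∃ σ : V → F, (∀ ⦃a b⦄, a ≠ w → b ≠ w → σ a = σ b → a = b) ∧ σ v = x ∧
        ∀ a b, a ≠ w → b ≠ w → H.Adj a b → χ s(σ a, σ b) ≠ i by
      obtain ⟨σ, hσ, hv, hi⟩ := h
      refine ⟨σ, ⟨hσ, fun a b ha hb h => ?_, fun a b a' b' ha hb ha' hb' _ _ h => ?_, hi⟩, hv⟩
      · exact fun e => h.ne (hσ ha hb e)
      · have := χ.injective h
        rw [Sym2.eq_iff] at this ⊢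
        rcases this with ⟨h1, h2⟩ | ⟨h1, h2⟩
        · exact Or.inl ⟨hσ ha ha' h1, hσ hb hb' h2⟩
        · exact Or.inr ⟨hσ ha hb' h1, hσ hb ha' h2⟩
    have key : ∀ {n : ℕ} (a : Fin n → V) (_ : Function.Injective a) (_ : ∀ k, a k ≠ w)
        (p : Fin n → F) (_ : Function.Injective p),
        ∃ σ : V → F, (∀ ⦃a b⦄, a ≠ w → b ≠ w → σ a = σ b → a = b) ∧ ∀ k, σ (a k) = p k := by
      intro n a ha haw p hp
      obtain ⟨σ, h1, h2⟩ := exists_bijOn_finset (Finset.univ.erase w) hFs a ha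
        (fun k => by simpa using haw k) p hp
      exact ⟨σ, fun a b ha hb => h1 (by simpa using ha) (by simpa using hb), h2⟩
    have hav : ∀ (σ : V → F), (∀ ⦃a b⦄, a ≠ w → b ≠ w → σ a = σ b → a = b) →
        ∀ a b a' b', a ≠ w → b ≠ w → a' ≠ w → b' ≠ w → ¬ H.Adj a' b' → H.Adj a b →
        s(σ a, σ b) ≠ s(σ a', σ b') := by
      intro σ hσ a b a' b' ha hb ha' hb' h' h e
      rw [Sym2.eq_iff] at e
      rcases e with ⟨h1, h2⟩ | ⟨h1, h2⟩
      · rw [hσ ha ha' h1, hσ hb hb' h2] at h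
        exact h' h
      · rw [hσ ha hb' h1, hσ hb ha' h2] at h
        exact h' h.symm
    -- At most one edge has colour `i`. If it is at `x`, the non-edge `v u₀` is laid over it; if it
    -- misses `x`, the non-edge `u₁ u₂` is.
    by_cases hi : ∃ p q : F, p ≠ q ∧ χ s(p, q) = i
    · obtain ⟨p, q, hpq, rfl⟩ := hi
      by_cases hx : x = p ∨ x = q
      · obtain ⟨y, hxy, hs⟩ : ∃ y, x ≠ y ∧ s(p, q) = s(x, y) := by
          rcases hx with rfl | rfl
          · exact ⟨q, hpq, rfl⟩
          · exact ⟨p, hpq.symm, Sym2.eq_swap⟩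
        obtain ⟨σ, hσ, hk⟩ := key ![v, u₀] (by
            intro i j; fin_cases i <;> fin_cases j <;> simp [hu₀v, hu₀v.symm])
          (by intro i; fin_cases i <;> simp [hvw, hu₀w])
          ![x, y] (by intro i j; fin_cases i <;> fin_cases j <;> simp [hxy, hxy.symm])
        have h0 : σ v = x := hk 0
        have h1 : σ u₀ = y := hk 1
        refine ⟨σ, hσ, h0, fun a b ha hb hab e => ?_⟩
        rw [hs, ← h0, ← h1] at e
        exact hav σ hσ a b v u₀ ha hb hvw hu₀w hu₀ hab (χ.injective e)
      · push Not at hx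
        obtain ⟨hxp, hxq⟩ := hx
        obtain ⟨σ, hσ, hk⟩ := key ![v, u₁, u₂] (by
            intro i j; fin_cases i <;> fin_cases j <;>
              simp [hu₁v, hu₁v.symm, hu₂v, hu₂v.symm, hu₁₂, hu₁₂.symm])
          (by intro i; fin_cases i <;> simp [hvw, hu₁w, hu₂w])
          ![x, p, q] (by
            intro i j; fin_cases i <;> fin_cases j <;>
              simp [hxp, hxp.symm, hxq, hxq.symm, hpq, hpq.symm])
        have h1 : σ u₁ = p := hk 1
        have h2 : σ u₂ = q := hk 2
        refine ⟨σ, hσ, hk 0, fun a b ha hb hab e => ?_⟩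
        rw [← h1, ← h2] at e
        exact hav σ hσ a b u₁ u₂ ha hb hu₁w hu₂w hu hab (χ.injective e)
    · push Not at hi
      obtain ⟨σ, hσ, hk⟩ := key ![v] (fun i j _ => Subsingleton.elim _ _)
        (by intro i; fin_cases i; simp [hvw]) ![x] (fun i j _ => Subsingleton.elim _ _)
      exact ⟨σ, hσ, hk 0, fun a b ha hb hab => hi _ _ fun e => hab.ne (hσ ha hb e)⟩

/-- The case of the path on four vertices `w, v, z, u₀`. -/
theorem hasLinearSaturated_of_path {V : Type*} {H : SimpleGraph V}
    (hconn : H.Connected) {v w z u₀ : V} (hvw : H.Adj v w) (hw : ∀ u, H.Adj w u → u = v)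
    (hV : ∀ a, a = v ∨ a = w ∨ a = z ∨ a = u₀) (hvz : H.Adj v z) (hzu₀ : H.Adj z u₀)
    (hu₀w : u₀ ≠ w) (hu₀v : u₀ ≠ v) (hzw : z ≠ w) (hu₀ : ¬ H.Adj v u₀) {t : ℕ} (ht : 4 ≤ t) :
    HasLinearSaturated H t := by
  classical
  let F := ZMod 2 × ZMod 2
  obtain ⟨χ⟩ : Nonempty (F ↪ Fin t) := by
    refine Function.Embedding.nonempty_of_card_le ?_
    simp only [F, Fintype.card_prod, ZMod.card, Fintype.card_fin]
    omega
  refine hasLinearSaturated_of_component hconn hvw.ne hw (G := (⊤ : SimpleGraph F))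
    (c := fun a b => χ (a + b)) (fun a b => by rw [add_comm]) ?_ ?_
  · intro f hf
    -- The four elements of the group sum to zero, so opposite edges of the `K_4` share a colour,
    -- and the two end edges of a spanning path are opposite.
    have h4 : ∀ a b c d : F, a ≠ b → a ≠ c → a ≠ d → b ≠ c → b ≠ d → c ≠ d → a + b = c + d := by
      decide
    have hI := hf.injective
    have := hf.rainbow hvw hzu₀ (congrArg χ (h4 _ _ _ _ (hI.ne hvw.ne) (hI.ne hvz.ne)
      (hI.ne hu₀v.symm) (hI.ne hzw.symm) (hI.ne hu₀w.symm) (hI.ne hzu₀.ne)))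
    rw [Sym2.eq_iff] at this
    have h1 := hvz.ne
    tauto
  · intro x i
    -- Of the three nonzero differences at most one carries the colour `i`; the other two are the
    -- steps of the path from `x`.
    obtain ⟨p, q, hp, hq, hpq, hpi, hqi⟩ :
        ∃ p q : F, p ≠ 0 ∧ q ≠ 0 ∧ p ≠ q ∧ χ p ≠ i ∧ χ q ≠ i := by
      by_cases hi : ∃ j, χ j = i
      · obtain ⟨j, rfl⟩ := hi
        have : ∀ j : F, ∃ p q : F, p ≠ 0 ∧ q ≠ 0 ∧ p ≠ q ∧ p ≠ j ∧ q ≠ j := by decide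
        obtain ⟨p, q, h1, h2, h3, h4, h5⟩ := this j
        exact ⟨p, q, h1, h2, h3, χ.injective.ne h4, χ.injective.ne h5⟩
      · push Not at hi
        exact ⟨(0, 1), (1, 0), by decide, by decide, by decide, hi _, hi _⟩
    have e1 : ∀ x p q : F, x + (x + p) = p ∧ (x + p) + (x + p + q) = q := by decide
    have e2 : ∀ x p q : F, (x + p) + x = p ∧ (x + p + q) + (x + p) = q := by decide
    have e3 : ∀ x p q : F, p ≠ 0 → q ≠ 0 → p ≠ q → x ≠ x + p ∧ x ≠ x + p + q ∧
      x + p ≠ x + p + q := by decide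
    obtain ⟨d1, d2, d3⟩ := e3 x p q hp hq hpq
    let f : V → F := fun a => if a = v then x else if a = z then x + p else x + p + q
    have fv : f v = x := if_pos rfl
    have fz : f z = x + p := by simp [f, hvz.ne.symm]
    have fu : f u₀ = x + p + q := by simp [f, hu₀v, hzu₀.ne.symm]
    have hedge : ∀ a b, a ≠ w → b ≠ w → H.Adj a b →
        (s(a, b) = s(v, z) ∧ f a + f b = p) ∨ (s(a, b) = s(z, u₀) ∧ f a + f b = q) := by
      intro a b ha hb hab
      have hab' := hab.ne
      rcases hV a with rfl | rfl | rfl | rfl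
      · rcases hV b with rfl | rfl | rfl | rfl
        · exact absurd rfl hab'
        · exact absurd rfl hb
        · exact Or.inl ⟨rfl, by rw [fv, fz, (e1 x p q).1]⟩
        · exact absurd hab hu₀
      · exact absurd rfl ha
      · rcases hV b with rfl | rfl | rfl | rfl
        · exact Or.inl ⟨Sym2.eq_swap, by rw [fv, fz, (e2 x p q).1]⟩
        · exact absurd rfl hb
        · exact absurd rfl hab'
        · exact Or.inr ⟨rfl, by rw [fz, fu, (e1 x p q).2]⟩
      · rcases hV b with rfl | rfl | rfl | rfl
        · exact absurd hab.symm hu₀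
        · exact absurd rfl hb
        · exact Or.inr ⟨Sym2.eq_swap, by rw [fz, fu, (e2 x p q).2]⟩
        · exact absurd rfl hab'
    have hinj : ∀ a b, a ≠ w → b ≠ w → f a = f b → a = b := by
      intro a b ha hb h
      rcases hV a with rfl | rfl | rfl | rfl <;> rcases hV b with rfl | rfl | rfl | rfl <;>
        first
        | rfl
        | exact absurd rfl ha
        | exact absurd rfl hb
        | (rw [fv, fz] at h; exact absurd h d1)
        | (rw [fv, fu] at h; exact absurd h d2)
        | (rw [fz, fv] at h; exact absurd h.symm d1)
        | (rw [fu, fv] at h; exact absurd h.symm d2)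
        | (rw [fz, fu] at h; exact absurd h d3)
        | (rw [fu, fz] at h; exact absurd h.symm d3)
    refine ⟨f, ⟨hinj, fun a b ha hb h e => h.ne (hinj a b ha hb e),
      fun a b a' b' ha hb ha' hb' h h' e => ?_, fun a b ha hb h => ?_⟩, fv⟩
    · have e' := χ.injective e
      rcases hedge a b ha hb h with ⟨h1, h2⟩ | ⟨h1, h2⟩ <;>
        rcases hedge a' b' ha' hb' h' with ⟨h3, h4⟩ | ⟨h3, h4⟩
      · rw [h1, h3]
      · exact absurd (h2.symm.trans (e'.trans h4)) hpq
      · exact absurd (h4.symm.trans (e'.symm.trans h2)) hpq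
      · rw [h1, h3]
    · rcases hedge a b ha hb h with ⟨-, h2⟩ | ⟨-, h2⟩
      · simpa only [h2] using hpi
      · simpa only [h2] using hqi

/-! ### Few neighbours in the clique: the hub graph -/

/-- The successor in `Fin m`, fixing the last element. -/
def nextFin {m : ℕ} (a : Fin m) : Fin m := if h : a.val + 1 < m then ⟨a.val + 1, h⟩ else a

theorem nextFin_val {m : ℕ} {a : Fin m} (h : a.val + 1 < m) : (nextFin a).val = a.val + 1 := by
  simp [nextFin, h]

theorem nextFin_edge_injective {m : ℕ} {a b : Fin m} (ha : a.val + 1 < m) (hb : b.val + 1 < m)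
    (h : s(a, nextFin a) = s(b, nextFin b)) : a = b := by
  rw [Sym2.eq_iff] at h
  rcases h with ⟨h, -⟩ | ⟨h1, h2⟩
  · exact h
  · have e1 := congrArg Fin.val h1
    have e2 := congrArg Fin.val h2
    rw [nextFin_val hb] at e1
    rw [nextFin_val ha] at e2
    omega

/-- Two disjoint cliques on `m` vertices, and infinitely many further vertices, each joined to the
vertices `0, …, d` of both cliques. -/
def hubGraph (m d : ℕ) : SimpleGraph ((Bool × Fin m) ⊕ ℕ) where
  Adj
    | .inl a, .inl b => a.1 = b.1 ∧ a.2 ≠ b.2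
    | .inl a, .inr _ => a.2.val ≤ d
    | .inr _, .inl a => a.2.val ≤ d
    | .inr _, .inr _ => False
  symm := ⟨by
    rintro (a | x) (b | y) h
    · exact ⟨h.1.symm, h.2.symm⟩
    · exact h
    · exact h
    · exact h⟩
  loopless := ⟨by
    rintro (a | x) h
    · exact h.2 rfl
    · exact h⟩

/-- The cliques of `hubGraph` are rainbow with disjoint palettes, and the edges from the vertex `a`
of a clique to the outside get the colour of the edge `{a, a + 1}` of the other clique. -/
def hubColour {m : ℕ} : (Bool × Fin m) ⊕ ℕ → (Bool × Fin m) ⊕ ℕ → Option (Bool × Sym2 (Fin m))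
  | .inl a, .inl b => some (a.1 && b.1, s(a.2, b.2))
  | .inl a, .inr _ => some (!a.1, s(a.2, nextFin a.2))
  | .inr _, .inl a => some (!a.1, s(a.2, nextFin a.2))
  | .inr _, .inr _ => none

theorem hubColour_symm {m : ℕ} (x y : (Bool × Fin m) ⊕ ℕ) : hubColour x y = hubColour y x := by
  rcases x with a | x <;> rcases y with b | y
  · change some _ = some _
    rw [Bool.and_comm, Sym2.eq_swap]
  · rfl
  · rfl
  · rfl

theorem hubColour_inl {m : ℕ} (k : Bool) (a b : Fin m) :
    hubColour (.inl (k, a)) (.inl (k, b)) = some (k, s(a, b)) := by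
  simp [hubColour]

/-- Pigeonhole: a part of the copy that is as large as its target set fills it, leaving no room
there for other vertices. -/
theorem hubGraph_clique_image {V : Type*} {m : ℕ} {f : V → (Bool × Fin m) ⊕ ℕ}
    (hf : Function.Injective f) {S : Finset V} {T : Finset (Fin m)} {k : Bool}
    (h : ∀ a ∈ S, ∃ b ∈ T, f a = .inl (k, b)) :
    S.card ≤ T.card ∧ (T.card ≤ S.card → ∀ b ∈ T, ∃ a ∈ S, f a = .inl (k, b)) := by
  classical
  have hsub : S.image f ⊆ T.image fun b => .inl (k, b) := by
    intro x hx
    obtain ⟨a, ha, rfl⟩ := Finset.mem_image.1 hx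
    obtain ⟨b, hb, e⟩ := h a ha
    exact Finset.mem_image.2 ⟨b, hb, e.symm⟩
  have h1 : (S.image f).card = S.card := Finset.card_image_of_injective _ hf
  have h2 : (T.image fun b => (.inl (k, b) : (Bool × Fin m) ⊕ ℕ)).card = T.card :=
    Finset.card_image_of_injective _ fun b b' e => by simpa using e
  refine ⟨by rw [← h1, ← h2]; exact Finset.card_le_card hsub, fun hle b hb => ?_⟩
  have := Finset.eq_of_subset_of_card_le hsub (by rw [h1, h2]; exact hle)
  have hb' : (.inl (k, b) : (Bool × Fin m) ⊕ ℕ) ∈ S.image f := by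
    rw [this]
    exact Finset.mem_image_of_mem _ hb
  exact Finset.mem_image.1 hb'

section

variable {V : Type*} {H : SimpleGraph V} {v w : V}
  {Q D : Finset V} {m d : ℕ} {f : V → (Bool × Fin m) ⊕ ℕ}

/-- Here `Q` fills clique `k`, so `v` lies outside and `w` is a hub `b'` of the other clique. The
edge `vw` then has the colour of `{b', b' + 1}` in clique `k`, already used in `Q`. -/
theorem not_isRainbowCopy_hubGraph_of_clique_inl (hvw : H.Adj v w) (hm : d + 2 ≤ m)
    (hQ : ∀ a, a ∈ Q ↔ a ≠ v ∧ a ≠ w) (hQclique : ∀ a ∈ Q, ∀ b ∈ Q, a ≠ b → H.Adj a b)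
    (hQcard : Q.card = m) (hDne : ∃ u ∈ Q, H.Adj v u)
    (hf : IsRainbowCopy H (hubGraph m d) hubColour f) (k : Bool)
    (hk : ∀ a ∈ Q, ∃ b : Fin m, f a = .inl (k, b)) : False := by
  have hI := hf.injective
  have hsurj : ∀ b, ∃ a ∈ Q, f a = .inl (k, b) := fun b =>
    (hubGraph_clique_image hI (S := Q) (T := Finset.univ) (k := k) fun a ha => by
      obtain ⟨b, hb⟩ := hk a ha
      exact ⟨b, Finset.mem_univ _, hb⟩).2 (by simp [hQcard]) b (Finset.mem_univ _)
  have hnot : ∀ u, u ∉ Q → ∀ b, f u ≠ .inl (k, b) := by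
    intro u hu b e
    obtain ⟨a, ha, e'⟩ := hsurj b
    exact hu (hI (e.trans e'.symm) ▸ ha)
  have hvQ : v ∉ Q := fun h => ((hQ v).1 h).1 rfl
  have hwQ : w ∉ Q := fun h => ((hQ w).1 h).2 rfl
  obtain ⟨u, huQ, hvu⟩ := hDne
  obtain ⟨b, hb⟩ := hk u huQ
  have h1 := hf.adj hvu
  have h2 := hf.adj hvw
  rw [hb] at h1
  rcases hv : f v with ⟨k', b'⟩ | x
  · rw [hv] at h1
    obtain rfl : k' = k := h1.1
    exact hnot v hvQ b' hv
  rw [hv] at h2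
  rcases hw' : f w with ⟨k', b'⟩ | x'
  · rw [hw'] at h2
    have hb' : b'.val ≤ d := h2
    by_cases hkk : k' = k
    · subst hkk
      exact hnot w hwQ b' hw'
    · obtain ⟨α, hα, eα⟩ := hsurj b'
      obtain ⟨β, hβ, eβ⟩ := hsurj (nextFin b')
      have hval := nextFin_val (a := b') (by omega)
      have hαβ : α ≠ β := by
        rintro rfl
        rw [eα] at eβ
        have := congrArg Fin.val (Prod.mk.inj (Sum.inl.inj eβ)).2
        omega
      have := hf.rainbow hvw (hQclique α hα β hβ hαβ) (by
        rw [hv, hw', eα, eβ, hubColour_inl]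
        change some (!k', _) = _
        rw [← Bool.eq_not.2 (Ne.symm hkk)])
      rw [Sym2.eq_iff] at this
      rcases this with ⟨h, -⟩ | ⟨h, -⟩
      · exact hvQ (h ▸ hα)
      · exact hvQ (h ▸ hβ)
  · rw [hw'] at h2
    exact h2

/-- With `z` outside, the other `m - 1` vertices of `Q` are hubs of clique `k`. This forces `m = d +
2`, and these vertices are all `d + 1` hubs. If `v` is in clique `k`, it is the one non-hub and no
place for `w` is left. If `v` is outside, its edge to a vertex of `Q` repeats the colour of the edge
from `z`. -/
theorem not_isRainbowCopy_hubGraph_of_clique_inr [DecidableEq V] (hvw : H.Adj v w) (hm : d + 2 ≤ m)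
    (hQ : ∀ a, a ∈ Q ↔ a ≠ v ∧ a ≠ w) (hQclique : ∀ a ∈ Q, ∀ b ∈ Q, a ≠ b → H.Adj a b)
    (hQcard : Q.card = m) (hDne : ∃ u ∈ Q, H.Adj v u)
    (hD : ∀ u, u ∈ D ↔ u ∈ Q ∧ H.Adj v u) (hd : D.card = d)
    (hf : IsRainbowCopy H (hubGraph m d) hubColour f) (k : Bool) {z : V} (hz : z ∈ Q) {x : ℕ}
    (hfz : f z = .inr x) (hk : ∀ a ∈ Q, a ≠ z → ∃ b : Fin m, f a = .inl (k, b)) : False := by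
  have hI := hf.injective
  have hvQ : v ∉ Q := fun h => ((hQ v).1 h).1 rfl
  have hwQ : w ∉ Q := fun h => ((hQ w).1 h).2 rfl
  have hzv : z ≠ v := ((hQ z).1 hz).1
  have hzw : z ≠ w := ((hQ z).1 hz).2
  have hT : (Finset.univ.filter fun b : Fin m => b.val ≤ d).card = d + 1 := by
    have : (Finset.univ.filter fun b : Fin m => b.val ≤ d) = Finset.Iic ⟨d, by omega⟩ := by
      ext b
      simp [Fin.le_def]
    rw [this, Fin.card_Iic]
  have hS : (Q.erase z).card = m - 1 := by rw [Finset.card_erase_of_mem hz, hQcard]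
  obtain ⟨hle, hsurj⟩ := hubGraph_clique_image hI (S := Q.erase z)
    (T := Finset.univ.filter fun b : Fin m => b.val ≤ d) (k := k) (fun a ha => by
      obtain ⟨haz, haQ⟩ := Finset.mem_erase.1 ha
      obtain ⟨b, hb⟩ := hk a haQ haz
      refine ⟨b, ?_, hb⟩
      have := hf.adj (hQclique a haQ z hz haz)
      rw [hb, hfz] at this
      exact Finset.mem_filter.2 ⟨Finset.mem_univ _, this⟩)
  rw [hT, hS] at hle hsurj
  have hmd : m = d + 2 := by omega
  replace hsurj : ∀ b : Fin m, b.val ≤ d → ∃ a ∈ Q, a ≠ z ∧ f a = .inl (k, b) := by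
    intro b hb
    obtain ⟨a, ha, e⟩ := hsurj (by omega) b (by simpa using hb)
    exact ⟨a, (Finset.mem_erase.1 ha).2, (Finset.mem_erase.1 ha).1, e⟩
  have hnot : ∀ u, u ∉ Q → ∀ b : Fin m, b.val ≤ d → f u ≠ .inl (k, b) := by
    intro u hu b hb e
    obtain ⟨a, ha, -, e'⟩ := hsurj b hb
    exact hu (hI (e.trans e'.symm) ▸ ha)
  have h2 := hf.adj hvw
  rcases hv : f v with ⟨k', b'⟩ | x'
  · by_cases hkk : k' = k
    · subst hkk
      have hb' : ¬ b'.val ≤ d := fun h => hnot v hvQ b' h hv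
      rw [hv] at h2
      rcases hw' : f w with ⟨k'', b''⟩ | x'
      · rw [hw'] at h2
        obtain ⟨e1, e2⟩ := h2
        obtain rfl : k' = k'' := e1
        refine hnot w hwQ b'' ?_ hw'
        have : b'.val ≠ b''.val := fun h => e2 (Fin.ext h)
        omega
      · rw [hw'] at h2
        exact hb' h2
    -- With `v` in the other clique, `z` is its only neighbour in `Q`, so `d = 1` and `m = 3`. In
    -- this small case every position of `v` and `w` repeats a colour.
    · have honly : ∀ u ∈ Q, H.Adj v u → u = z := by
        intro u hu hvu
        by_contra huz
        obtain ⟨b, hb⟩ := hk u hu huz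
        have := hf.adj hvu
        rw [hv, hb] at this
        exact hkk this.1
      obtain ⟨u, huQ, hvz⟩ := hDne
      obtain rfl := honly u huQ hvz
      have hd1 : d = 1 := by
        rw [← hd, Finset.card_eq_one]
        refine ⟨u, ?_⟩
        ext a
        rw [hD, Finset.mem_singleton]
        constructor
        · rintro ⟨h1, h2⟩
          exact honly a h1 h2
        · rintro rfl
          exact ⟨huQ, hvz⟩
      subst hd1
      subst hmd
      have hk'k : (!k') = k := (Bool.eq_not.2 (Ne.symm hkk)).symm
      have hkk' : (!k) = k' := (Bool.eq_not.2 hkk).symm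
      have h3 := hf.adj hvz
      rw [hv, hfz] at h3
      replace h3 : b'.val ≤ 1 := h3
      obtain ⟨α, hαQ, hαz, eα⟩ := hsurj 0 (by simp)
      obtain ⟨β, hβQ, hβz, eβ⟩ := hsurj 1 (by simp)
      have hαβ : α ≠ β := by
        rintro rfl
        rw [eα] at eβ
        simp at eβ
      have n0 : nextFin (0 : Fin (1 + 2)) = 1 := by decide
      have n1 : nextFin (1 : Fin (1 + 2)) = 2 := by decide
      have hcz : hubColour (f v) (f u) = some (k, s(b', nextFin b')) := by
        rw [hv, hfz]
        change some (!k', _) = _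
        rw [hk'k]
      have hvα : v ≠ α := fun h => hvQ (h ▸ hαQ)
      have hvβ : v ≠ β := fun h => hvQ (h ▸ hβQ)
      have hb1 : b' = 1 := by
        by_contra hb1
        have hb0 : b' = 0 := by
          have : b'.val ≠ 1 := fun h => hb1 (Fin.ext h)
          apply Fin.ext
          change b'.val = 0
          omega
        have := hf.rainbow hvz (hQclique α hαQ β hβQ hαβ) (by
          rw [hcz, eα, eβ, hubColour_inl, hb0, n0])
        rw [Sym2.eq_iff] at this
        tauto
      subst hb1
      have cα : hubColour (f u) (f α) = some (k', s(0, 1)) := by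
        rw [hfz, eα]
        change some (!k, _) = _
        rw [hkk', n0]
      have cβ : hubColour (f u) (f β) = some (k', s(1, 2)) := by
        rw [hfz, eβ]
        change some (!k, _) = _
        rw [hkk', n1]
      have hvw' := hvw.ne
      rw [hv] at h2
      rcases hw' : f w with ⟨k'', b''⟩ | x'
      · rw [hw'] at h2
        obtain ⟨e1, e2⟩ := h2
        obtain rfl : k' = k'' := e1
        have hb : b'' = 0 ∨ b'' = 2 := by
          have : ∀ b : Fin (1 + 2), 1 ≠ b → b = 0 ∨ b = 2 := by decide
          exact this b'' e2
        rcases hb with rfl | rfl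
        · have := hf.rainbow hvw (hQclique u hz α hαQ (Ne.symm hαz)) (by
            rw [cα, hv, hw', hubColour_inl, Sym2.eq_swap])
          rw [Sym2.eq_iff] at this
          have := hzv.symm
          tauto
        · have := hf.rainbow hvw (hQclique u hz β hβQ (Ne.symm hβz)) (by
            rw [cβ, hv, hw', hubColour_inl])
          rw [Sym2.eq_iff] at this
          have := hzv.symm
          tauto
      · have := hf.rainbow hvw hvz (by rw [hv, hw', hfz]; rfl)
        rw [Sym2.eq_iff] at this
        have := hzw.symm
        tauto
  · obtain ⟨u, huQ, hvu⟩ := hDne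
    have h3 := hf.adj hvu
    have huz : u ≠ z := by
      rintro rfl
      rw [hv, hfz] at h3
      exact h3
    obtain ⟨b, hb⟩ := hk u huQ huz
    have := hf.rainbow hvu (hQclique z hz u huQ huz.symm) (by rw [hv, hb, hfz]; rfl)
    rw [Sym2.eq_iff] at this
    have := hzv.symm
    have := hvu.ne
    tauto

/-- Outer vertices are independent and the two cliques are not joined. So the clique `Q` has at most
one outer vertex and otherwise lies in a single clique. -/
theorem not_isRainbowCopy_hubGraph [DecidableEq V] (hvw : H.Adj v w) (hm : d + 2 ≤ m)
    (hQ : ∀ a, a ∈ Q ↔ a ≠ v ∧ a ≠ w) (hQclique : ∀ a ∈ Q, ∀ b ∈ Q, a ≠ b → H.Adj a b)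
    (hQcard : Q.card = m) (hDne : ∃ u ∈ Q, H.Adj v u)
    (hD : ∀ u, u ∈ D ↔ u ∈ Q ∧ H.Adj v u) (hd : D.card = d) :
    ¬ IsRainbowCopy H (hubGraph m d) hubColour f := by
  intro hf
  have hd0 : 0 < d := by
    obtain ⟨u, hu, h⟩ := hDne
    rw [← hd]
    exact Finset.card_pos.2 ⟨u, (hD _).2 ⟨hu, h⟩⟩
  have hinl : ∀ a ∈ Q, ∀ b ∈ Q, ∀ k i k' i', f a = .inl (k, i) → f b = .inl (k', i') → k = k' := by
    intro a ha b hb k i k' i' ea eb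
    by_cases hab : a = b
    · rw [hab, eb] at ea
      exact (Prod.mk.inj (Sum.inl.inj ea)).1.symm
    · have := hf.adj (hQclique a ha b hb hab)
      rw [ea, eb] at this
      exact this.1
  by_cases hz : ∃ z ∈ Q, ∃ x, f z = .inr x
  · obtain ⟨z, hz, x, hx⟩ := hz
    have hother : ∀ a ∈ Q, a ≠ z → ∃ k, ∃ b : Fin m, f a = .inl (k, b) := by
      intro a ha haz
      have := hf.adj (hQclique a ha z hz haz)
      rcases h : f a with ⟨k, b⟩ | y
      · exact ⟨k, b, rfl⟩
      · rw [h, hx] at this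
        exact absurd this id
    obtain ⟨a, ha⟩ : (Q.erase z).Nonempty := by
      rw [← Finset.card_pos, Finset.card_erase_of_mem hz]
      omega
    obtain ⟨haz, haQ⟩ := Finset.mem_erase.1 ha
    obtain ⟨k, b, hb⟩ := hother a haQ haz
    refine not_isRainbowCopy_hubGraph_of_clique_inr hvw hm hQ hQclique hQcard hDne hD hd hf k hz hx
      fun a' ha' ha'z => ?_
    obtain ⟨k', b', hb'⟩ := hother a' ha' ha'z
    exact ⟨b', by rw [hb', hinl a haQ a' ha' _ _ _ _ hb hb']⟩
  · push Not at hz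
    have hall : ∀ a ∈ Q, ∃ k, ∃ b : Fin m, f a = .inl (k, b) := by
      intro a ha
      rcases h : f a with ⟨k, b⟩ | y
      · exact ⟨k, b, rfl⟩
      · exact absurd h (hz a ha y)
    obtain ⟨a, ha, hva⟩ := hDne
    obtain ⟨k, b, hb⟩ := hall a ha
    refine not_isRainbowCopy_hubGraph_of_clique_inl hvw hm hQ hQclique hQcard ⟨_, ha, hva⟩ hf k
      fun a' ha' => ?_
    obtain ⟨k', b', hb'⟩ := hall a' ha'
    exact ⟨b', by rw [hb', hinl a ha a' ha' _ _ _ _ hb hb']⟩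

/-- `Q` is put on a clique without colour `i`, and `v` on an outer vertex; the edges at `v` then use
the other clique's palette. -/
theorem exists_isPartialCopy_hubGraph [DecidableEq V] {K : Type*} (hvw : v ≠ w) (hm : d + 2 ≤ m)
    (hQ : ∀ a, a ∈ Q ↔ a ≠ v ∧ a ≠ w) (hQcard : Q.card = m)
    (hD : ∀ u, u ∈ D ↔ u ∈ Q ∧ H.Adj v u) (hd : D.card = d)
    (χ : Option (Bool × Sym2 (Fin m)) ↪ K) (i : K) (x y : ℕ) :
    ∃ f, IsPartialCopy H w (hubGraph m d) (fun a b => χ (hubColour a b)) i f ∧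
      f v = .inr x ∧ f w = .inr y ∧ ∀ a ∈ Q, ∃ b, f a = .inl b := by
  obtain ⟨k, hk⟩ : ∃ k, ∀ e, χ (some (k, e)) ≠ i := by
    by_cases h : ∃ k e, χ (some (k, e)) = i
    · obtain ⟨k, e, rfl⟩ := h
      refine ⟨!k, fun e' h => ?_⟩
      have := χ.injective h
      simp at this
    · push Not at h
      exact ⟨true, h true⟩
  -- At most one of the `d + 1` hubs has colour `i` on its outer edges. Avoiding it leaves exactly
  -- the `d` hubs needed for the neighbours of `v`.
  obtain ⟨a₀, ha₀⟩ : ∃ a₀ : Fin (d + 1), ∀ b : Fin m, b.val ≤ d →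
      χ (some (!k, s(b, nextFin b))) = i → b.val = a₀.val := by
    by_cases h : ∃ b : Fin m, b.val ≤ d ∧ χ (some (!k, s(b, nextFin b))) = i
    · obtain ⟨b, hb, rfl⟩ := h
      refine ⟨⟨b.val, by omega⟩, fun b' hb' e => ?_⟩
      have := χ.injective e
      rw [Option.some_inj, Prod.mk.injEq] at this
      rw [nextFin_edge_injective (by omega) (by omega) this.2]
    · push Not at h
      exact ⟨0, fun b hb e => absurd e (h b hb)⟩
  let e := D.equivFinOfCardEq hd
  have : Nonempty (Fin m) := ⟨⟨0, by omega⟩⟩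
  obtain ⟨σ, hσ, hσD⟩ := exists_bijOn_finset (P := Fin m) Q (by simp [hQcard])
    (fun j => (e.symm j).1) (Subtype.val_injective.comp e.symm.injective)
    (fun j => ((hD _).1 (e.symm j).2).1)
    (fun j => Fin.castLE (by omega) (a₀.succAbove j))
    (fun i j h => Fin.succAbove_right_injective (Fin.castLE_injective _ h))
  have hσD' : ∀ u ∈ Q, H.Adj v u → (σ u).val ≤ d ∧ (σ u).val ≠ a₀.val := by
    intro u hu hvu
    have := hσD (e ⟨u, (hD _).2 ⟨hu, hvu⟩⟩)
    simp only [Equiv.symm_apply_apply] at this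
    rw [this]
    refine ⟨Nat.lt_succ_iff.1 (a₀.succAbove _).isLt, fun h => ?_⟩
    exact Fin.succAbove_ne a₀ _ (Fin.ext h)
  let f : V → (Bool × Fin m) ⊕ ℕ := fun a =>
    if a = v then .inr x else if a = w then .inr y else .inl (k, σ a)
  have fv : f v = .inr x := if_pos rfl
  have fw : f w = .inr y := by simp [f, hvw.symm]
  have fQ : ∀ a ∈ Q, f a = .inl (k, σ a) := by
    intro a ha
    obtain ⟨h1, h2⟩ := (hQ a).1 ha
    simp [f, h1, h2]
  have hcase : ∀ a, a ≠ w → a = v ∨ a ∈ Q := by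
    intro a ha
    by_cases h : a = v
    · exact Or.inl h
    · exact Or.inr ((hQ a).2 ⟨h, ha⟩)
  have hedge : ∀ a b, a ≠ w → b ≠ w → H.Adj a b →
      (a ∈ Q ∧ b ∈ Q) ∨ ∃ u ∈ Q, H.Adj v u ∧ s(a, b) = s(v, u) := by
    intro a b ha hb hab
    rcases hcase a ha with rfl | ha
    · rcases hcase b hb with rfl | hb
      · exact absurd rfl hab.ne
      · exact Or.inr ⟨b, hb, hab, rfl⟩
    · rcases hcase b hb with rfl | hb
      · exact Or.inr ⟨a, ha, hab.symm, Sym2.eq_swap⟩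
      · exact Or.inl ⟨ha, hb⟩
  have hcolQ : ∀ a ∈ Q, ∀ b ∈ Q, hubColour (f a) (f b) = some (k, s(σ a, σ b)) := by
    intro a ha b hb
    rw [fQ a ha, fQ b hb, hubColour_inl]
  have hcolv : ∀ a b, ∀ u ∈ Q, s(a, b) = s(v, u) →
      hubColour (f a) (f b) = some (!k, s(σ u, nextFin (σ u))) := by
    intro a b u hu h
    rw [Sym2.eq_iff] at h
    rcases h with ⟨rfl, rfl⟩ | ⟨rfl, rfl⟩
    · rw [fv, fQ _ hu]; rfl
    · rw [fv, fQ _ hu]; rfl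
  refine ⟨f, ⟨fun a b ha hb h => ?_, fun a b ha hb hab => ?_,
    fun a b a' b' ha hb ha' hb' h h' e => ?_, fun a b ha hb h => ?_⟩, fv, fw,
    fun a ha => ⟨_, fQ a ha⟩⟩
  · rcases hcase a ha with rfl | ha <;> rcases hcase b hb with rfl | hb
    · rfl
    · rw [fv, fQ b hb] at h
      exact absurd h (by simp)
    · rw [fv, fQ a ha] at h
      exact absurd h (by simp)
    · rw [fQ a ha, fQ b hb] at h
      exact hσ ha hb (Prod.mk.inj (Sum.inl.inj h)).2
  · rcases hcase a ha with rfl | ha <;> rcases hcase b hb with rfl | hb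
    · exact absurd rfl hab.ne
    · rw [fv, fQ b hb]
      exact (hσD' b hb hab).1
    · rw [fv, fQ a ha]
      exact (hσD' a ha hab.symm).1
    · rw [fQ a ha, fQ b hb]
      exact ⟨rfl, fun e => hab.ne (hσ ha hb e)⟩
  · have e' := χ.injective e
    rcases hedge a b ha hb h with ⟨ha, hb⟩ | ⟨u, hu, hvu, hs⟩ <;>
      rcases hedge a' b' ha' hb' h' with ⟨ha', hb'⟩ | ⟨u', hu', hvu', hs'⟩
    · rw [hcolQ a ha b hb, hcolQ a' ha' b' hb', Option.some_inj, Prod.mk.injEq, Sym2.eq_iff] at e'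
      rw [Sym2.eq_iff]
      rcases e'.2 with ⟨h1, h2⟩ | ⟨h1, h2⟩
      · exact Or.inl ⟨hσ ha ha' h1, hσ hb hb' h2⟩
      · exact Or.inr ⟨hσ ha hb' h1, hσ hb ha' h2⟩
    · rw [hcolQ a ha b hb, hcolv a' b' u' hu' hs'] at e'
      simp at e'
    · rw [hcolQ a' ha' b' hb', hcolv a b u hu hs] at e'
      simp at e'
    · rw [hcolv a b u hu hs, hcolv a' b' u' hu' hs', Option.some_inj, Prod.mk.injEq] at e'
      have h1 := (hσD' u hu hvu).1
      have h2 := (hσD' u' hu' hvu').1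
      rw [hs, hs', hσ hu hu' (nextFin_edge_injective (by omega) (by omega) e'.2)]
  · rcases hedge a b ha hb h with ⟨ha, hb⟩ | ⟨u, hu, hvu, hs⟩
    · rw [hcolQ a ha b hb]
      exact hk _
    · rw [hcolv a b u hu hs]
      intro e
      exact (hσD' u hu hvu).2 (ha₀ _ (hσD' u hu hvu).1 e)

/-- The case of a clique `Q` on `m` vertices, a vertex `v` with at most `m - 2` neighbours in `Q`
and a leaf `w` at `v`. -/
theorem hasLinearSaturated_of_few_neighbours [DecidableEq V] (hvw : H.Adj v w) (hw : ∀ u, H.Adj w u → u = v)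
    (hm : d + 2 ≤ m) (hQ : ∀ a, a ∈ Q ↔ a ≠ v ∧ a ≠ w)
    (hQclique : ∀ a ∈ Q, ∀ b ∈ Q, a ≠ b → H.Adj a b)
    (hQcard : Q.card = m) (hDne : ∃ u ∈ Q, H.Adj v u)
    (hD : ∀ u, u ∈ D ↔ u ∈ Q ∧ H.Adj v u) (hd : D.card = d) {t : ℕ} (ht : (m + 2) ^ 2 ≤ t) :
    HasLinearSaturated H t := by
  obtain ⟨χ⟩ : Nonempty (Option (Bool × Sym2 (Fin m)) ↪ Fin t) := by
    refine Function.Embedding.nonempty_of_card_le ?_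
    rw [Fintype.card_option, Fintype.card_prod, Sym2.card, Fintype.card_fin, Fintype.card_fin,
      Fintype.card_bool, Nat.choose_two_right]
    have := Nat.mul_div_le ((m + 1) * (m + 1 - 1)) 2
    rw [Nat.add_sub_cancel] at this ⊢
    nlinarith
  refine hasLinearSaturated_of_scaffold (G := hubGraph m d) (c := fun a b => χ (hubColour a b))
    (fun a b => congrArg χ (hubColour_symm a b)) ?_ (2 * m) fun n => ?_
  · rintro ⟨f, hf⟩
    exact not_isRainbowCopy_hubGraph hvw hm hQ hQclique hQcard hDne hD hd (f := f)
      ⟨hf.injective, hf.adj, fun a b a' b' h h' e => hf.rainbow h h' (congrArg χ e)⟩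
  · let e : Bool × Fin m ≃ Fin (2 * m) := Fintype.equivFinOfCardEq (by simp)
    let p : Fin n → (Bool × Fin m) ⊕ ℕ := fun x =>
      if h : x.val < 2 * m then .inl (e.symm ⟨x.val, h⟩) else .inr x.val
    have hp1 : ∀ x : Fin n, ∀ h : x.val < 2 * m, p x = .inl (e.symm ⟨x.val, h⟩) :=
      fun x h => dif_pos h
    have hp2 : ∀ x : Fin n, ¬ x.val < 2 * m → p x = .inr x.val := fun x h => dif_neg h
    have hp : Function.Injective p := by
      intro x y h
      by_cases hx : x.val < 2 * m <;> by_cases hy : y.val < 2 * m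
      · rw [hp1 x hx, hp1 y hy] at h
        simpa [Fin.ext_iff] using h
      · rw [hp1 x hx, hp2 y hy] at h
        simp at h
      · rw [hp2 x hx, hp1 y hy] at h
        simp at h
      · rw [hp2 x hx, hp2 y hy] at h
        simpa [Fin.ext_iff] using h
    -- The exceptional set is the two cliques, and the fibres are singletons: all pairs of outer
    -- vertices are saturated.
    refine ⟨p, hp, Finset.univ.filter fun x => x.val < 2 * m, ?_, fun x => x.val, fun j => ?_,
      fun x y hx hy hxy => ?_⟩
    · refine (Finset.card_le_card_of_injOn (t := Finset.range (2 * m)) Fin.val ?_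
        Fin.val_injective.injOn).trans (Finset.card_range _).le
      intro x hx
      simpa using hx
    · refine le_trans (Finset.card_le_one.2 fun a ha b hb => ?_) (by omega : 1 ≤ 2 * m)
      simp only [Finset.mem_filter, Finset.mem_univ, true_and] at ha hb
      exact Fin.ext (ha.trans hb.symm)
    · simp only [Finset.mem_filter, Finset.mem_univ, true_and] at hx hy
      rw [hp2 x hx, hp2 y hy]
      refine ⟨id, fun i => ?_⟩
      obtain ⟨f, hf, fv, fw, fQ⟩ := exists_isPartialCopy_hubGraph (H := H) hvw.ne hm hQ hQcard hD hd
        χ i x.val y.val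
      refine ⟨f, ?_, fun a => ?_⟩
      · rw [← fv, ← fw]
        refine hf.isRainbowCopy hw (fun a ha h => ?_) (fun h => ?_)
        · by_cases hav : a = v
          · rw [hav, fv, fw] at h
            exact hxy (Sum.inr.inj h)
          · obtain ⟨b, hb⟩ := fQ a ((hQ a).2 ⟨hav, ha⟩)
            rw [hb, fw] at h
            simp at h
        · rw [fv, fw] at h
          exact hxy (Sum.inr.inj h)
      · by_cases hav : a = v
        · exact ⟨x, by rw [hav, fv, hp2 x hx]⟩
        by_cases haw : a = w
        · exact ⟨y, by rw [haw, fw, hp2 y hy]⟩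
        obtain ⟨b, hb⟩ := fQ a ((hQ a).2 ⟨hav, haw⟩)
        have hlt := (e b).isLt
        have hxn := x.isLt
        refine ⟨⟨(e b).val, by omega⟩, ?_⟩
        rw [hp1 _ hlt, hb, Fin.eta, Equiv.symm_apply_apply]

end

/-! ### Star partitions from a one-factorization -/

/-- A family of bijective colourings of the edges of the complete graph on `P` by the colours in
`C`, such that for each vertex the stars in the different colourings partition `C`. -/
structure IsStarPartition {S P C : Type*} (φ : S → P → P → C) : Prop where
  symm : ∀ k p q, φ k p q = φ k q p
  surj : ∀ k j, ∃ p q, p ≠ q ∧ φ k p q = j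
  inj : ∀ ⦃k p q p' q'⦄, p ≠ q → p' ≠ q' → φ k p q = φ k p' q' → s(p, q) = s(p', q')
  cover : ∀ p j, ∃ k q, p ≠ q ∧ φ k p q = j
  disjoint : ∀ ⦃k l p q q'⦄, p ≠ q → p ≠ q' → φ k p q = φ l p q' → k = l

section Factorization

variable {s : ℕ}

/-- The matching that contains the pair `p`, `q`, in the standard factorization of the complete
graph on `2 * s` vertices. -/
def matchingOf : Option (ZMod (2 * s - 1)) → Option (ZMod (2 * s - 1)) → ZMod (2 * s - 1)
  | some a, some b => a + b
  | some a, none => 2 * a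
  | none, some a => 2 * a
  | none, none => 0

/-- The index of the edge at `p` in the matching `m`. -/
def matchingIndex (m : ZMod (2 * s - 1)) : Option (ZMod (2 * s - 1)) → ℕ
  | some a => (a - m * (s : ZMod (2 * s - 1))).valMinAbs.natAbs
  | none => 0

/-- `s` is the inverse of `2` modulo `2 * s - 1`, so `m * s` is the midpoint of the matching `m`. -/
theorem two_mul_half (hs : 1 ≤ s) : 2 * (s : ZMod (2 * s - 1)) = 1 := by
  have : ((2 * s - 1 + 1 : ℕ) : ZMod (2 * s - 1)) = 1 := by
    rw [Nat.cast_add, ZMod.natCast_self, Nat.cast_one, zero_add]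
  rw [← this]
  rw [show 2 * s - 1 + 1 = 2 * s by omega]
  push_cast
  rfl

theorem matchingOf_comm (p q : Option (ZMod (2 * s - 1))) : matchingOf p q = matchingOf q p := by
  rcases p with _ | a <;> rcases q with _ | b
  · rfl
  · rfl
  · rfl
  · exact add_comm a b

theorem two_mul_cancel (hs : 1 ≤ s) {a b : ZMod (2 * s - 1)} (h : 2 * a = 2 * b) : a = b := by
  have e := two_mul_half hs
  linear_combination (s : ZMod (2 * s - 1)) * h - (a - b) * e

theorem matchingOf_cancel (hs : 1 ≤ s) {p q q' : Option (ZMod (2 * s - 1))} (hq : p ≠ q)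
    (hq' : p ≠ q') (h : matchingOf p q = matchingOf p q') : q = q' := by
  rcases p with _ | a <;> rcases q with _ | b <;> rcases q' with _ | b' <;>
    simp only [matchingOf] at h
  · rfl
  · exact absurd rfl hq
  · exact absurd rfl hq'
  · rw [two_mul_cancel hs h]
  · rfl
  · exact absurd (by rw [show a = b' by linear_combination h]) hq'
  · exact absurd (by rw [show a = b by linear_combination -h]) hq
  · rw [add_left_cancel h]

theorem exists_matchingOf_eq (hs : 1 ≤ s) (p : Option (ZMod (2 * s - 1))) (m : ZMod (2 * s - 1)) :
    ∃ q, p ≠ q ∧ matchingOf p q = m := by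
  rcases p with _ | a
  · refine ⟨some (m * s), by simp, ?_⟩
    change 2 * (m * s) = m
    linear_combination m * two_mul_half hs
  · by_cases h : 2 * a = m
    · exact ⟨none, by simp, h⟩
    · refine ⟨some (m - a), fun e => h ?_, ?_⟩
      · have := Option.some.inj e
        linear_combination this
      · change a + (m - a) = m
        ring

/-- The matching `m` pairs the points at equal distance on both sides of its midpoint, and the
midpoint itself with `none`; the index is that distance, so it names the edge. -/
theorem matchingIndex_eq_iff (hs : 1 ≤ s) {m : ZMod (2 * s - 1)}
    {p q : Option (ZMod (2 * s - 1))} (hpq : p ≠ q) :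
    matchingIndex m p = matchingIndex m q ↔ matchingOf p q = m := by
  have e := two_mul_half hs
  rcases p with _ | a <;> rcases q with _ | b <;> simp only [matchingOf, matchingIndex]
  · exact absurd rfl hpq
  · rw [eq_comm, Int.natAbs_eq_zero, ZMod.valMinAbs_eq_zero]
    constructor
    · intro h
      linear_combination 2 * h + m * e
    · intro h
      linear_combination (s : ZMod (2 * s - 1)) * h - b * e
  · rw [Int.natAbs_eq_zero, ZMod.valMinAbs_eq_zero]
    constructor
    · intro h
      linear_combination 2 * h + m * e
    · intro h
      linear_combination (s : ZMod (2 * s - 1)) * h - a * e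
  · rw [ZMod.natAbs_valMinAbs_eq_natAbs_valMinAbs]
    constructor
    · rintro (h | h)
      · exact absurd (by rw [sub_left_inj.1 h]) hpq
      · linear_combination h + m * e
    · intro h
      right
      linear_combination h - m * e

theorem matchingIndex_lt (hs : 1 ≤ s) (m : ZMod (2 * s - 1)) (p : Option (ZMod (2 * s - 1))) :
    matchingIndex m p < s := by
  have : NeZero (2 * s - 1) := ⟨by omega⟩
  rcases p with _ | a
  · exact hs
  · have := ZMod.natAbs_valMinAbs_le (a - m * (s : ZMod (2 * s - 1)))
    change (a - m * s).valMinAbs.natAbs < s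
    omega

theorem exists_matchingIndex_eq (hs : 1 ≤ s) (m : ZMod (2 * s - 1)) {n : ℕ} (hn : n < s) :
    ∃ p, matchingIndex m p = n := by
  have : NeZero (2 * s - 1) := ⟨by omega⟩
  refine ⟨some (m * s + n), ?_⟩
  change (m * s + n - m * s).valMinAbs.natAbs = n
  rw [add_sub_cancel_left, ZMod.valMinAbs_natCast_of_le_half (by omega), Int.natAbs_natCast]

/-- The `k`-th colouring: the pair of the matching and the index in it, shifted by `k`. -/
def shiftedColour (k : ZMod s) (p q : Option (ZMod (2 * s - 1))) : ZMod (2 * s - 1) × ZMod s :=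
  (matchingOf p q, (matchingIndex (matchingOf p q) p : ZMod s) + k)

/-- Each point has one edge in each matching. The `s` shifts move its index through all residues
modulo `s`, so each colour occurs at the point for exactly one shift. -/
theorem isStarPartition_shiftedColour (hs : 1 ≤ s) :
    IsStarPartition (shiftedColour (s := s)) := by
  have : NeZero s := ⟨by omega⟩
  have hcast : ∀ (m m' : ZMod (2 * s - 1)) (p p' : Option (ZMod (2 * s - 1))),
      (matchingIndex m p : ZMod s) = matchingIndex m' p' →
        matchingIndex m p = matchingIndex m' p' := by
    intro m m' p p' h
    have := congrArg ZMod.val h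
    rwa [ZMod.val_natCast_of_lt (matchingIndex_lt hs _ _),
      ZMod.val_natCast_of_lt (matchingIndex_lt hs _ _)] at this
  refine ⟨fun k p q => ?_, fun k j => ?_, fun k p q p' q' hpq hpq' h => ?_, fun p j => ?_,
    fun k l p q q' hq hq' h => ?_⟩
  · by_cases hpq : p = q
    · rw [hpq]
    · unfold shiftedColour
      rw [matchingOf_comm q p, (matchingIndex_eq_iff hs hpq).2 rfl]
  · obtain ⟨p, hp⟩ := exists_matchingIndex_eq hs j.1 (ZMod.val_lt (j.2 - k))
    obtain ⟨q, hpq, hq⟩ := exists_matchingOf_eq hs p j.1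
    refine ⟨p, q, hpq, ?_⟩
    unfold shiftedColour
    rw [hq, hp, ZMod.natCast_zmod_val, sub_add_cancel]
  · unfold shiftedColour at h
    rw [Prod.mk.injEq] at h
    obtain ⟨h1, h2⟩ := h
    have h3 := hcast _ _ _ _ (add_right_cancel h2)
    rw [Sym2.eq_iff]
    by_cases hpp : p = p'
    · subst hpp
      exact Or.inl ⟨rfl, matchingOf_cancel hs hpq hpq' h1⟩
    · right
      rw [← h1, matchingIndex_eq_iff hs hpp] at h3
      have h4 := matchingOf_cancel hs hpp hpq h3
      refine ⟨matchingOf_cancel hs (Ne.symm hpp) hpq' ?_, h4.symm⟩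
      rw [← h1, matchingOf_comm, h3]
  · obtain ⟨q, hpq, hq⟩ := exists_matchingOf_eq hs p j.1
    refine ⟨j.2 - matchingIndex j.1 p, q, hpq, ?_⟩
    unfold shiftedColour
    rw [hq, add_sub_cancel]
  · unfold shiftedColour at h
    rw [Prod.mk.injEq] at h
    obtain ⟨h1, h2⟩ := h
    rw [← h1] at h2
    exact add_left_cancel h2

end Factorization

/-! ### Cliques with a rotated edge, even order: the block graph -/

section Block

variable {S P C : Type*} [DecidableEq S] [DecidableEq P]

/-- Two vertices with the same block label in direction `k` lie in a common block. -/
def blockLabel (k : S) (x : P × (S × P → ZMod 2)) : S × P → ZMod 2 :=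
  x.2 + Pi.single (k, x.1) 1

theorem blockLabel_apply (k : S) (x : P × (S × P → ZMod 2)) (l : S) (q : P) :
    blockLabel k x (l, q) = x.2 (l, q) + if l = k ∧ q = x.1 then 1 else 0 := by
  simp [blockLabel, Pi.single_apply]

theorem blockLabel_ext {k : S} {x y : P × (S × P → ZMod 2)} (h1 : x.1 = y.1)
    (h : blockLabel k x = blockLabel k y) : x = y := by
  refine Prod.ext h1 ?_
  unfold blockLabel at h
  rw [h1] at h
  exact add_right_cancel h

/-- At the coordinate `(k, x.1)`, equal labels in direction `k` force the bits of `x` and `y` to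
differ, while a direction other than `k` forces them to agree. -/
theorem blockLabel_unique {k l : S} {x y : P × (S × P → ZMod 2)} (h1 : x.1 ≠ y.1)
    (hk : blockLabel k x = blockLabel k y) (hl : blockLabel l x = blockLabel l y) : k = l := by
  by_contra hkl
  have e1 := congrFun hk (k, x.1)
  have e2 := congrFun hl (k, x.1)
  simp only [blockLabel_apply, h1, hkl, and_false, false_and, and_self, if_true, if_false,
    add_zero] at e1 e2
  rw [← e2] at e1
  simp at e1

/-- The bit at `(k, x.1)` flips from `x` to `y` and is constant from `y` to `z`, whose first
components are not `x.1`. Only direction `k` can flip it back. -/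
theorem blockLabel_triangle {k l j : S} {x y z : P × (S × P → ZMod 2)} (hxy : x.1 ≠ y.1)
    (hxz : x.1 ≠ z.1) (hk : blockLabel k x = blockLabel k y)
    (hl : blockLabel l y = blockLabel l z) (hj : blockLabel j x = blockLabel j z) : j = k := by
  by_contra hjk
  have e1 := congrFun hk (k, x.1)
  have e2 := congrFun hl (k, x.1)
  have e3 := congrFun hj (k, x.1)
  simp only [blockLabel_apply, hxy, hxz, Ne.symm hjk, and_false, false_and, and_self, if_true,
    if_false, add_zero] at e1 e2 e3
  rw [← e2, ← e1] at e3
  simp at e3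

/-- The graph formed by cliques, the blocks, in `S` directions; any two blocks share at most one
vertex, and each triangle is contained in a block. -/
def blockGraph (S P : Type*) [DecidableEq S] [DecidableEq P] :
    SimpleGraph (P × (S × P → ZMod 2)) where
  Adj x y := x.1 ≠ y.1 ∧ ∃ k, blockLabel k x = blockLabel k y
  symm := ⟨fun _ _ h => ⟨h.1.symm, h.2.imp fun _ e => e.symm⟩⟩
  loopless := ⟨fun _ h => h.1 rfl⟩

/-- The colouring of the block graph which is `φ k` on the blocks of direction `k`. -/
noncomputable def blockColour [Nonempty S] (φ : S → P → P → C)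
    (x y : P × (S × P → ZMod 2)) : C :=
  φ (Classical.epsilon fun k => blockLabel k x = blockLabel k y) x.1 y.1

theorem blockColour_eq [Nonempty S] (φ : S → P → P → C) {k : S} {x y : P × (S × P → ZMod 2)}
    (h1 : x.1 ≠ y.1) (hk : blockLabel k x = blockLabel k y) :
    blockColour φ x y = φ k x.1 y.1 := by
  have := Classical.epsilon_spec (p := fun k => blockLabel k x = blockLabel k y) ⟨k, hk⟩
  rw [blockColour, blockLabel_unique h1 hk this]

theorem blockColour_symm [Nonempty S] {φ : S → P → P → C} (hφ : IsStarPartition φ)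
    (x y : P × (S × P → ZMod 2)) : blockColour φ x y = blockColour φ y x := by
  unfold blockColour
  rw [hφ.symm]
  congr 2
  funext k
  exact propext eq_comm

variable {V : Type*} [Fintype V] [DecidableEq V] [Fintype P] {H : SimpleGraph V} {v w u₀ : V}

/-- `H - w` is a clique minus an edge, linked through triangles, so it lies in one block and fills
it. The edge `vw` therefore leaves the block, and its colour occurs in that block: on the missing
pair `v u₀` it contradicts disjointness of the stars at `v`, elsewhere it is a repeated colour. -/
theorem not_isRainbowCopy_blockGraph [Nonempty S] {φ : S → P → P → C} (hφ : IsStarPartition φ)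
    (hcard : (Finset.univ.erase w).card = Fintype.card P) (hP : 4 ≤ Fintype.card P)
    (hvw : H.Adj v w) (hu₀w : u₀ ≠ w) (hu₀v : u₀ ≠ v)
    (hadj : ∀ a b, a ≠ w → b ≠ w → a ≠ b → s(a, b) ≠ s(v, u₀) → H.Adj a b)
    (f : V → P × (S × P → ZMod 2)) :
    ¬ IsRainbowCopy H (blockGraph S P) (blockColour φ) f := by
  intro hf
  have hI := hf.injective
  -- Two further vertices `z`, `z'` exist as `4 ≤ |P|`; the triangle `z z' u₀` ties `u₀` to the
  -- block of `v`.
  have hlt : 1 < (((Finset.univ.erase w).erase v).erase u₀).card := by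
    rw [Finset.card_erase_of_mem (by simp [hu₀w, hu₀v]),
      Finset.card_erase_of_mem (by simp [hvw.ne])]
    omega
  obtain ⟨z, hz, z', hz', hzz⟩ := Finset.one_lt_card.1 hlt
  simp only [Finset.mem_erase, Finset.mem_univ, and_true] at hz hz'
  obtain ⟨hzu, hzv, hzw⟩ := hz
  obtain ⟨hzu', hzv', hzw'⟩ := hz'
  have hva : ∀ a, a ≠ w → a ≠ v → a ≠ u₀ → H.Adj v a := by
    intro a h1 h2 h3
    refine hadj v a hvw.ne h1 h2.symm ?_
    rw [Ne, Sym2.eq_iff]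
    tauto
  have haa : ∀ a b, a ≠ w → b ≠ w → a ≠ v → b ≠ v → a ≠ b → H.Adj a b := by
    intro a b h1 h2 h3 h4 h5
    refine hadj a b h1 h2 h5 ?_
    rw [Ne, Sym2.eq_iff]
    tauto
  have htri : ∀ a b c k, H.Adj a b → H.Adj b c → H.Adj a c →
      blockLabel k (f a) = blockLabel k (f b) → blockLabel k (f a) = blockLabel k (f c) := by
    intro a b c k hab hbc hac hk
    obtain ⟨h1, -⟩ := hf.adj hab
    obtain ⟨-, l, hl⟩ := hf.adj hbc
    obtain ⟨h3, j, hj⟩ := hf.adj hac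
    have := blockLabel_triangle h1 h3 hk hl hj
    rwa [this] at hj
  obtain ⟨-, k, hk⟩ := hf.adj (hva z hzw hzv hzu)
  have hQ : ∀ a, a ≠ w → a ≠ v → a ≠ u₀ → blockLabel k (f v) = blockLabel k (f a) := by
    intro a h1 h2 h3
    by_cases haz : a = z
    · rw [haz, hk]
    · exact htri v z a k (hva z hzw hzv hzu) (haa z a hzw h1 hzv h2 (Ne.symm haz))
        (hva a h1 h2 h3) hk
  have hall : ∀ a, a ≠ w → blockLabel k (f v) = blockLabel k (f a) := by
    intro a h1
    by_cases h2 : a = v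
    · rw [h2]
    by_cases h3 : a = u₀
    · subst h3
      rw [hk]
      exact htri z z' a k (haa z z' hzw hzw' hzv hzv' hzz)
        (haa z' a hzw' h1 hzv' h2 hzu') (haa z a hzw h1 hzv h2 hzu)
        (hk.symm.trans (hQ z' hzw' hzv' hzu'))
    · exact hQ a h1 h2 h3
  have hpos : Set.InjOn (fun a => (f a).1) (Finset.univ.erase w : Finset V) := by
    intro a ha b hb h
    simp only [Finset.coe_erase, Set.mem_sdiff, Set.mem_singleton_iff] at ha hb
    exact hI (blockLabel_ext h ((hall a ha.2).symm.trans (hall b hb.2)))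
  have hsurj : ∀ p, ∃ a, a ≠ w ∧ (f a).1 = p := by
    intro p
    have himg : (Finset.univ.erase w).image (fun a => (f a).1) = Finset.univ := by
      rw [← Finset.card_eq_iff_eq_univ, Finset.card_image_of_injOn hpos, hcard]
    have hp := Finset.mem_univ p
    rw [← himg, Finset.mem_image] at hp
    obtain ⟨a, ha, e⟩ := hp
    exact ⟨a, (Finset.mem_erase.1 ha).1, e⟩
  obtain ⟨hpw, l, hl⟩ := hf.adj hvw
  have hkl : k ≠ l := by
    rintro rfl
    obtain ⟨a, ha, e⟩ := hsurj (f w).1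
    exact ha (hI (blockLabel_ext e ((hall a ha).symm.trans hl)))
  obtain ⟨p, q, hpq, hφk⟩ := hφ.surj k (φ l (f v).1 (f w).1)
  obtain ⟨a, ha, rfl⟩ := hsurj p
  obtain ⟨b, hb, rfl⟩ := hsurj q
  have hab : a ≠ b := fun h => hpq (by rw [h])
  by_cases hs : s(a, b) = s(v, u₀)
  · rw [Sym2.eq_iff] at hs
    rcases hs with ⟨rfl, rfl⟩ | ⟨rfl, rfl⟩
    · exact hkl (hφ.disjoint hpq hpw hφk)
    · rw [hφ.symm] at hφk
      exact hkl (hφ.disjoint hpq.symm hpw hφk)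
  · have := hf.rainbow (hadj a b ha hb hab hs) hvw (by
      rw [blockColour_eq φ hpq ((hall a ha).symm.trans (hall b hb)), blockColour_eq φ hpw hl, hφk])
    rw [Sym2.eq_iff] at this
    tauto

theorem exists_isPartialCopy_blockGraph [Nonempty S] {K : Type*} {φ : S → P → P → C}
    (hφ : IsStarPartition φ) (hcard : (Finset.univ.erase w).card = Fintype.card P)
    (hP : 4 ≤ Fintype.card P) (hvw : v ≠ w) (hu₀w : u₀ ≠ w) (hu₀v : u₀ ≠ v)
    (hvu₀ : ¬ H.Adj v u₀) (χ : C ↪ K) (x : P × (S × P → ZMod 2)) (i : K) :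
    ∃ f, IsPartialCopy H w (blockGraph S P) (fun a b => χ (blockColour φ a b)) i f ∧ f v = x := by
  have : Nonempty P := ⟨x.1⟩
  -- By the covering property some block through `x` has the colour `i` on an edge at `x`; the
  -- non-edge `v u₀` is placed there.
  obtain ⟨k, q₀, hq₀, hi⟩ : ∃ k q₀, x.1 ≠ q₀ ∧
      ∀ p q, p ≠ q → χ (φ k p q) = i → s(p, q) = s(x.1, q₀) := by
    by_cases h : ∃ j, χ j = i
    · obtain ⟨j, rfl⟩ := h
      obtain ⟨k, q, hq, rfl⟩ := hφ.cover x.1 j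
      exact ⟨k, q, hq, fun p' q' hpq e => hφ.inj hpq hq (χ.injective e)⟩
    · push Not at h
      obtain ⟨q, hq⟩ := Fintype.exists_ne_of_one_lt_card (by omega) x.1
      exact ⟨Classical.arbitrary S, q, hq.symm, fun p' q' _ e => absurd e (h _)⟩
  obtain ⟨σ, hσ, hσ'⟩ := exists_bijOn_finset (Finset.univ.erase w) hcard ![v, u₀] (by
      intro i j; fin_cases i <;> fin_cases j <;> simp [hu₀v, hu₀v.symm])
    (by intro i; fin_cases i <;> simp [hvw, hu₀w])
    ![x.1, q₀] (by intro i j; fin_cases i <;> fin_cases j <;> simp [hq₀, hq₀.symm])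
  have hσv : σ v = x.1 := hσ' 0
  have hσu : σ u₀ = q₀ := hσ' 1
  replace hσ : ∀ ⦃a b⦄, a ≠ w → b ≠ w → σ a = σ b → a = b :=
    fun a b ha hb => hσ (by simpa using ha) (by simpa using hb)
  -- The block of `x` in direction `k` has exactly one vertex over each element of `P`.
  let f : V → P × (S × P → ZMod 2) := fun a =>
    (σ a, blockLabel k x - Pi.single (k, σ a) 1)
  have hlab : ∀ a, blockLabel k (f a) = blockLabel k x := fun a => sub_add_cancel _ _
  have hne : ∀ a b, a ≠ w → b ≠ w → H.Adj a b → (f a).1 ≠ (f b).1 :=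
    fun a b ha hb h e => h.ne (hσ ha hb e)
  have hcol : ∀ a b, a ≠ w → b ≠ w → H.Adj a b → blockColour φ (f a) (f b) = φ k (σ a) (σ b) :=
    fun a b ha hb h => blockColour_eq φ (hne a b ha hb h) ((hlab a).trans (hlab b).symm)
  have hs : ∀ a b a' b', a ≠ w → b ≠ w → a' ≠ w → b' ≠ w → s(σ a, σ b) = s(σ a', σ b') →
      s(a, b) = s(a', b') := by
    intro a b a' b' ha hb ha' hb' h
    rw [Sym2.eq_iff] at h ⊢
    rcases h with ⟨h1, h2⟩ | ⟨h1, h2⟩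
    · exact Or.inl ⟨hσ ha ha' h1, hσ hb hb' h2⟩
    · exact Or.inr ⟨hσ ha hb' h1, hσ hb ha' h2⟩
  refine ⟨f, ⟨fun a b ha hb h => hσ ha hb (congrArg Prod.fst h),
    fun a b ha hb h => ⟨hne a b ha hb h, k, (hlab a).trans (hlab b).symm⟩,
    fun a b a' b' ha hb ha' hb' h h' e => ?_, fun a b ha hb h e => ?_⟩,
    blockLabel_ext hσv (hlab v)⟩
  · have e' := χ.injective e
    rw [hcol a b ha hb h, hcol a' b' ha' hb' h'] at e'
    exact hs a b a' b' ha hb ha' hb' (hφ.inj (hne a b ha hb h) (hne a' b' ha' hb' h') e')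
  · rw [hcol a b ha hb h] at e
    have e' := hi _ _ (hne a b ha hb h) e
    rw [← hσv, ← hσu] at e'
    have e'' := hs a b v u₀ ha hb hvw hu₀w e'
    rw [← SimpleGraph.mem_edgeSet, e''] at h
    exact hvu₀ h

end Block

/-- The case of the clique on `2 * s` vertices with a rotated edge. -/
theorem hasLinearSaturated_of_even {V : Type*} [Fintype V] [DecidableEq V] {H : SimpleGraph V}
    (hconn : H.Connected) {v w u₀ : V} (hvw : H.Adj v w) (hw : ∀ u, H.Adj w u → u = v)
    (hu₀w : u₀ ≠ w) (hu₀v : u₀ ≠ v) (hvu₀ : ¬ H.Adj v u₀)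
    (hadj : ∀ a b, a ≠ w → b ≠ w → a ≠ b → s(a, b) ≠ s(v, u₀) → H.Adj a b)
    {s : ℕ} (hs : 2 ≤ s) (hcard : Fintype.card V = 2 * s + 1) {t : ℕ}
    (ht : Fintype.card V ^ 2 ≤ t) : HasLinearSaturated H t := by
  have : NeZero s := ⟨by omega⟩
  have : NeZero (2 * s - 1) := ⟨by omega⟩
  have hP : Fintype.card (Option (ZMod (2 * s - 1))) = 2 * s := by
    rw [Fintype.card_option, ZMod.card]
    omega
  have hφ := isStarPartition_shiftedColour (s := s) (by omega)
  obtain ⟨χ⟩ : Nonempty (ZMod (2 * s - 1) × ZMod s ↪ Fin t) := by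
    refine Function.Embedding.nonempty_of_card_le ?_
    rw [Fintype.card_prod, ZMod.card, ZMod.card, Fintype.card_fin]
    refine le_trans ?_ ht
    rw [hcard, sq]
    exact Nat.mul_le_mul (by omega) (by omega)
  have hcard' : (Finset.univ.erase w).card = Fintype.card (Option (ZMod (2 * s - 1))) := by
    rw [Finset.card_erase_of_mem (Finset.mem_univ _), Finset.card_univ, hcard, hP]
    rfl
  refine hasLinearSaturated_of_component hconn hvw.ne hw
    (G := blockGraph (ZMod s) (Option (ZMod (2 * s - 1))))
    (c := fun a b => χ (blockColour shiftedColour a b))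
    (fun a b => congrArg χ (blockColour_symm hφ a b)) (fun f hf => ?_) (fun x i => ?_)
  · exact not_isRainbowCopy_blockGraph hφ hcard' (by omega) hvw hu₀w hu₀v hadj f
      ⟨hf.injective, hf.adj, fun a b a' b' h h' e => hf.rainbow h h' (congrArg χ e)⟩
  · exact exists_isPartialCopy_blockGraph hφ hcard' (by omega) hvw.ne hu₀w hu₀v hvu₀ χ x i

/-! ### Assembling the cases -/

theorem rotateEdge_adj_some {V : Type*} {u v p q : V} :
    (rotateEdge u v).Adj (some p) (some q) ↔ p ≠ q ∧ s(p, q) ≠ s(u, v) := by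
  simp [rotateEdge, SimpleGraph.edge_adj, SimpleGraph.map_adj']

theorem rotateEdge_adj_none {V : Type*} {u v p : V} :
    (rotateEdge u v).Adj (some p) none ↔ p = u := by
  simp [rotateEdge, SimpleGraph.edge_adj, SimpleGraph.map_adj']

theorem isCliqueWithRotatedEdge_of_adj {V : Type*} [Fintype V] [DecidableEq V]
    {H : SimpleGraph V} {v w u₀ : V} (hvw : H.Adj v w) (hw : ∀ u, H.Adj w u → u = v)
    (hu₀w : u₀ ≠ w) (hu₀v : u₀ ≠ v) (hvu₀ : ¬ H.Adj v u₀)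
    (hadj : ∀ a b, a ≠ w → b ≠ w → a ≠ b → s(a, b) ≠ s(v, u₀) → H.Adj a b)
    {r : ℕ} (hcard : Fintype.card V = r + 1) : IsCliqueWithRotatedEdge r H := by
  let e : {x // x ≠ w} ≃ Fin r := Fintype.equivFinOfCardEq (by
    rw [Fintype.card_subtype_compl, Fintype.card_subtype_eq, hcard]
    rfl)
  let E : V ≃ Option (Fin r) := (Equiv.optionSubtypeNe w).symm.trans (Equiv.optionCongr e)
  have hEw : E w = none := by simp [E]
  have hE : ∀ a (h : a ≠ w), E a = some (e ⟨a, h⟩) := by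
    intro a h
    simp [E, Equiv.optionSubtypeNe_symm_of_ne h]
  have hvw' := hvw.ne
  have hnone : ∀ a (h : a ≠ w), (rotateEdge (e ⟨v, hvw'⟩) (e ⟨u₀, hu₀w⟩)).Adj (E a) none ↔
      H.Adj a w := by
    intro a h
    rw [hE a h, rotateEdge_adj_none, e.apply_eq_iff_eq, Subtype.mk.injEq]
    constructor
    · rintro rfl
      exact hvw
    · exact fun h => hw a h.symm
  refine ⟨e ⟨v, hvw'⟩, e ⟨u₀, hu₀w⟩, fun h => ?_, ⟨⟨E, ?_⟩⟩⟩
  · exact hu₀v (congrArg Subtype.val (e.injective h)).symm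
  · intro a b
    by_cases ha : a = w
    · by_cases hb : b = w
      · rw [ha, hb]
        exact iff_of_false (SimpleGraph.irrefl _) (SimpleGraph.irrefl _)
      · rw [SimpleGraph.adj_comm, H.adj_comm, ha, hEw]
        exact hnone b hb
    · by_cases hb : b = w
      · rw [hb, hEw]
        exact hnone a ha
      · have hs : s(e ⟨a, ha⟩, e ⟨b, hb⟩) = s(e ⟨v, hvw'⟩, e ⟨u₀, hu₀w⟩) ↔ s(a, b) = s(v, u₀) := by
          simp
        rw [hE a ha, hE b hb, rotateEdge_adj_some, Ne, Ne, hs, e.apply_eq_iff_eq, Subtype.mk.injEq]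
        constructor
        · exact fun h => hadj a b ha hb h.1 h.2
        · refine fun h => ⟨h.ne, fun h' => ?_⟩
          rw [← SimpleGraph.mem_edgeSet, h'] at h
          exact hvu₀ h

theorem exists_ne_ne_of_three {V : Type*} {v w u : V} (hvw : v ≠ w) (huv : u ≠ v) (huw : u ≠ w)
    (a b : V) : ∃ z, z ≠ a ∧ z ≠ b := by
  by_contra hcon
  push Not at hcon
  have h1 := hcon v
  have h2 := hcon w
  have h3 := hcon u
  clear hcon
  by_cases k1 : v = a <;> by_cases k2 : w = a <;> by_cases k3 : u = a <;> simp_all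

/-- The case in which all vertices but `v` and the leaf `w` at `v` form a clique. -/
theorem hasLinearSaturated_of_clique {V : Type*} [Fintype V] [DecidableEq V] {H : SimpleGraph V}
    [DecidableRel H.Adj] (hconn : H.Connected)
    (hrot : ∀ r : ℕ, 5 ≤ r → Odd r → ¬ IsCliqueWithRotatedEdge r H) {v w u₀ : V}
    (hvw : H.Adj v w) (hw : ∀ u, H.Adj w u → u = v)
    (hu₀w : u₀ ≠ w) (hu₀v : u₀ ≠ v) (hvu₀ : ¬ H.Adj v u₀)
    (hclique : ∀ a b, a ≠ w → a ≠ v → b ≠ w → b ≠ v → a ≠ b → H.Adj a b) {t : ℕ}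
    (ht : Fintype.card V ^ 2 ≤ t) : HasLinearSaturated H t := by
  let Q : Finset V := (Finset.univ.erase w).erase v
  let D : Finset V := Q.filter fun u => H.Adj v u
  have hQ : ∀ a, a ∈ Q ↔ a ≠ v ∧ a ≠ w := fun a => by simp [Q]
  have hD : ∀ a, a ∈ D ↔ a ∈ Q ∧ H.Adj v a := fun a => Finset.mem_filter
  have hu₀Q : u₀ ∈ Q := (hQ _).2 ⟨hu₀v, hu₀w⟩
  have hQpos : 0 < Q.card := Finset.card_pos.2 ⟨u₀, hu₀Q⟩
  have hcard : Fintype.card V = Q.card + 2 := by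
    have : Q.card = Fintype.card V - 1 - 1 := by
      rw [Finset.card_erase_of_mem (by simp [hvw.ne]), Finset.card_erase_of_mem (by simp),
        Finset.card_univ]
    omega
  have hDne : ∃ u ∈ Q, H.Adj v u := by
    by_contra hcon
    push Not at hcon
    have := hconn.mem_of_adj_closed (S := {u | u = v ∨ u = w}) (fun a b hab ha => by
      rcases ha with rfl | rfl
      · by_contra hb
        simp only [Set.mem_ofPred_eq, not_or] at hb
        exact hcon b ((hQ b).2 hb) hab
      · exact Or.inl (hw b hab)) (Or.inl rfl : v = v ∨ v = w) u₀
    rcases this with h | h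
    · exact hu₀v h
    · exact hu₀w h
  have hDpos : 0 < D.card := by
    obtain ⟨u, hu, h⟩ := hDne
    exact Finset.card_pos.2 ⟨u, (hD u).2 ⟨hu, h⟩⟩
  have hDsub : D ⊆ Q.erase u₀ := by
    intro u hu
    obtain ⟨h1, h2⟩ := (hD u).1 hu
    refine Finset.mem_erase.2 ⟨?_, h1⟩
    rintro rfl
    exact hvu₀ h2
  have hQe : (Q.erase u₀).card = Q.card - 1 := Finset.card_erase_of_mem hu₀Q
  have hDle := Finset.card_le_card hDsub
  by_cases hm : D.card + 2 ≤ Q.card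
  · exact hasLinearSaturated_of_few_neighbours hvw hw hm hQ
      (fun a ha b hb => hclique a b ((hQ a).1 ha).2 ((hQ a).1 ha).1 ((hQ b).1 hb).2 ((hQ b).1 hb).1)
      rfl hDne hD rfl (by rwa [← hcard])
  -- Now `v` misses only `u₀` in `Q`, so `H` is the clique on `|Q| + 1` vertices with a rotated
  -- edge, and the parity of this order decides.
  have hDeq : D = Q.erase u₀ := Finset.eq_of_subset_of_card_le hDsub (by omega)
  have hva : ∀ a, a ≠ w → a ≠ v → a ≠ u₀ → H.Adj v a := by
    intro a h1 h2 h3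
    have : a ∈ D := by
      rw [hDeq]
      exact Finset.mem_erase.2 ⟨h3, (hQ a).2 ⟨h2, h1⟩⟩
    exact ((hD a).1 this).2
  have hadj : ∀ a b, a ≠ w → b ≠ w → a ≠ b → s(a, b) ≠ s(v, u₀) → H.Adj a b := by
    intro a b ha hb hab hs
    rw [Ne, Sym2.eq_iff] at hs
    by_cases hav : a = v
    · subst hav
      exact hva b hb hab.symm fun h => hs (Or.inl ⟨rfl, h⟩)
    by_cases hbv : b = v
    · subst hbv
      exact (hva a ha hab fun h => hs (Or.inr ⟨h, rfl⟩)).symm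
    exact hclique a b ha hav hb hbv hab
  rcases Nat.even_or_odd' (Q.card + 1) with ⟨s, hs | hs⟩
  · exact hasLinearSaturated_of_even hconn hvw hw hu₀w hu₀v hvu₀ hadj (s := s) (by omega)
      (by omega) ht
  · by_cases h5 : 5 ≤ Q.card + 1
    · exact absurd (isCliqueWithRotatedEdge_of_adj hvw hw hu₀w hu₀v hvu₀ hadj
        (r := Q.card + 1) hcard) (hrot _ h5 ⟨s, hs⟩)
    -- The order is odd, below `5` and at least `3`, so `|Q| = 2` and `H` is the path `w v z u₀`.
    · obtain ⟨z, hz, hvz⟩ := hDne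
      obtain ⟨hzv, hzw⟩ := (hQ z).1 hz
      have hzu : z ≠ u₀ := by
        rintro rfl
        exact hvu₀ hvz
      have hQ2 : {z, u₀} = Q := by
        refine Finset.eq_of_subset_of_card_le ?_ ?_
        · intro a ha
          rw [Finset.mem_insert, Finset.mem_singleton] at ha
          rcases ha with rfl | rfl
          · exact hz
          · exact hu₀Q
        · rw [Finset.card_pair hzu]
          omega
      refine hasLinearSaturated_of_path hconn hvw hw (z := z) (u₀ := u₀) (fun a => ?_) hvz
        (hclique z u₀ hzw hzv hu₀w hu₀v hzu) hu₀w hu₀v hzw hvu₀ ?_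
      · have := hQ a
        rw [← hQ2, Finset.mem_insert, Finset.mem_singleton] at this
        tauto
      · refine le_trans ?_ ht
        rw [hcard]
        nlinarith

end RainbowSat

theorem mainTheorem4 {V : Type*} [Fintype V] (H : SimpleGraph V) [DecidableRel H.Adj]
    (hconn : H.Connected)
    (hconical : ¬ ∃ x : V, RainbowSat.IsConical H x)
    (hpendant : ∃ e : Sym2 V, RainbowSat.IsPendantEdge H e)
    (hrot : ∀ r : ℕ, 5 ≤ r → Odd r → ¬ RainbowSat.IsCliqueWithRotatedEdge r H)
    (t : ℕ) (ht : Fintype.card V ^ 2 ≤ t) :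
    (fun n : ℕ => (RainbowSat.rainbowSat t n H : ℝ)) =Θ[atTop] (fun n : ℕ => (n : ℝ)) := by
  classical
  obtain ⟨e, he, w, hwe, hdeg⟩ := hpendant
  obtain ⟨v, rfl⟩ := hwe
  have hwv : H.Adj w v := he
  have hvw : H.Adj v w := hwv.symm
  have hw : ∀ u, H.Adj w u → u = v := by
    intro u hu
    rw [← SimpleGraph.card_neighborFinset_eq_degree, Finset.card_eq_one] at hdeg
    obtain ⟨x, hx⟩ := hdeg
    have h1 := (H.mem_neighborFinset w u).2 hu
    have h2 := (H.mem_neighborFinset w v).2 hwv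
    rw [hx, Finset.mem_singleton] at h1 h2
    rw [h1, h2]
  obtain ⟨u₀, hu₀v, hvu₀⟩ : ∃ u₀, u₀ ≠ v ∧ ¬ H.Adj v u₀ := by
    by_contra hcon
    push Not at hcon
    refine hconical ⟨v, ?_⟩
    have : H.neighborFinset v = Finset.univ.erase v := by
      ext u
      rw [SimpleGraph.mem_neighborFinset, Finset.mem_erase]
      exact ⟨fun h => ⟨h.ne.symm, Finset.mem_univ _⟩, fun h => hcon u h.1⟩
    rw [RainbowSat.IsConical, ← SimpleGraph.card_neighborFinset_eq_degree, this,
      Finset.card_erase_of_mem (Finset.mem_univ _), Finset.card_univ]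
  have hu₀w : u₀ ≠ w := by
    rintro rfl
    exact hvu₀ hvw
  have hthree := RainbowSat.exists_ne_ne_of_three hvw.ne hu₀v hu₀w
  have htpos : 0 < t := lt_of_lt_of_le (pow_pos (Fintype.card_pos_iff.2 ⟨v⟩) 2) ht
  refine RainbowSat.isTheta_of_hasLinearSaturated hconn hthree htpos ?_
  by_cases hclique : ∀ a b, a ≠ w → a ≠ v → b ≠ w → b ≠ v → a ≠ b → H.Adj a b
  · exact RainbowSat.hasLinearSaturated_of_clique hconn hrot hvw hw hu₀w hu₀v hvu₀ hclique ht
  · push Not at hclique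
    obtain ⟨a, b, haw, hav, hbw, hbv, hab, hnadj⟩ := hclique
    exact RainbowSat.hasLinearSaturated_of_not_clique hconn hvw.ne hw hu₀w hu₀v hvu₀ haw hav hbw
      hbv hab hnadj ht
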